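/- **Conventions.** Fix a field $k$. A persistence module $V$ is a functor from $(\mathbb R,\le)$ to $k$-vector spaces, with structure maps $\rho_{st}:V(s)\to V(t)$ for $s\le t$; it is pointwise finite-dimensional if every $V(t)$ is. Decorated endpoints are the elements of $\mathbb E=\mathbb R\times\{-,+\}\cup\{-\infty,\infty\}$, totally ordered by the order of the reals together with $r^-<r^+$; a nonempty interval of $\mathbb R$ is written $\langle a,b\rangle$ with $a<b$ in $\mathbb E$ (so $t\in\langle a,b\rangle$ iff $a\le t^-$ and $t^+\le b$). The interval module $k_I$ is $k$ on $I$ and $0$ elsewhere, with identity structure maps on $I$. A persistence basis of $V$ is an isomorphism $\alpha:\bigoplus_i k_{I_i}\to V$, with generators $\alpha_i:k_{I_i}\to V$. The barcode $\mathcal B(V)$ is the multiset of the intervals $I_i$, with multiplicities $m(I)$, and $\mathrm{Rep}(\mathcal B)=\{I_l:1\le l\le m(I)\}$. *Bauer–Lesnick matching.* Among the elements of $\mathrm{Rep}(\mathcal B)$ with a common right endpoint (or a common left endpoint), longer intervals come first, and copies of the same interval are ordered by their index. For an injective morphism $V\to U$, $\iota$ matches, for each $b\in\mathbb E$, the $i$-th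 interval of $\mathrm{Rep}(\mathcal B(V))$ ending at $b$ with the $i$-th interval of $\mathrm{Rep}(\mathcal B(U))$ ending at $b$. For a surjective morphism, $\lambda$ does the same with intervals starting at a common $a\in\mathbb E$. For $f:V\to U$ factored as $V\xrightarrow{h}\operatorname{Im}f\xrightarrow{j}U$, the matching is the partial function $\chi_f=\iota_{j}\circ\lambda_{h}:\mathrm{Rep}(\mathcal B(V))\to\mathrm{Rep}(\mathcal B(U))$. *The partial matching $\mathcal M_g$.* For $c\in\mathbb E$ let $\operatorname{Im}^+_{ct}(V)=\bigcap_{s\in\langle c,t^+\rangle}\operatorname{Im}\rho_{st}$, $\operatorname{Im}^-_{ct}(V)=\bigcup_{s\in\langle-\infty,c\rangle}\operatorname{Im}\rho_{st}$ (both for $t\in\langle c,\infty\rangle$), $\operatorname{Ker}^+_{ct}(V)=\bigcap_{r\in\langle c,\infty\rangle}\operatorname{Ker}\rho_{tr}$, $\operatorname{Ker}^-_{ct}(V)=\bigcup_{r\in\langle t^-,c\rangle}\operatorname{Ker}\rho_{tr}$ (both for $t\in\langle-\infty,c\rangle$), with $\operatorname{Im}^-_{-\infty,t}(V)=0$ and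 $\operatorname{Ker}^+_{\infty,t}(V)=V(t)$. For $I=\langle a,b\rangle$ and $t\in I$ put $V^+_{It}=\operatorname{Im}^+_{at}\cap\operatorname{Ker}^+_{bt}$ and $V^-_{It}=\operatorname{Im}^-_{at}\cap\operatorname{Ker}^+_{bt}+\operatorname{Im}^+_{at}\cap\operatorname{Ker}^-_{bt}$; both are $0$ for $t\notin I$. For $g:V\to U$ and intervals $I,J$ let $Y^+_{IJ}(t)=g(V^+_{It})\cap U^+_{Jt}$, $Y^-_{IJ}(t)=g(V^-_{It})+U^-_{Jt}$, $X_{IJ}[g]=Y^+_{IJ}/(Y^-_{IJ}\cap Y^+_{IJ})$ and $\mathcal M_g(I,J)=\#\mathcal B(X_{IJ}[g])$, counted with multiplicity. A partial matching between barcodes with multiplicity functions $m_1,m_2$ is a function $\mathcal M$ on pairs of intervals with values in $\mathbb Z_{\ge0}$ such that $\sum_J\mathcal M(I,J)\le m_1(I)$ and $\sum_I\mathcal M(I,J)\le m_2(J)$ for all $I$, $J$. A representation of it is an injective partial function $\sigma:\mathrm{Rep}(\mathcal B_1)\to\mathrm{Rep}(\mathcal B_2)$ such that, for all $I,J$, $\mathcal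 M(I,J)$ is the number of copies of $I$ that $\sigma$ sends to a copy of $J$. **Theorem.** Let $f:V\to U$ be a morphism between pointwise finite-dimensional persistence modules over $\mathbb R$. Then $V$, $U$ and $\operatorname{Im}f$ admit persistence bases. For $V$ and $U$ there are persistence bases whose generators are in bijection with the representation of the barcode, a generator with domain $k_I$ corresponding to a copy of $I$. For every choice of such bases $\alpha$ of $V$ and $\beta$ of $U$, with such bijections $\sigma_1$ from the generators of $\alpha$ to $\mathrm{Rep}(\mathcal B(V))$ and $\sigma_2$ from the generators of $\beta$ to $\mathrm{Rep}(\mathcal B(U))$, there is a morphism $g:V\to U$ such that 1. if $\chi_f(\sigma_1(\alpha_i))=\sigma_2(\beta_j)$, where $\alpha_i$ has domain $k_I$ and $\beta_j$ has domain $k_J$, then $g\circ\alpha_i=\beta_j\circ h$, where $h:k_I\to k_J$ is the identity of $k$ at each $t\in I\cap J$ and $0$ at all other $t$; and $g\circ\alpha_i=0$ if $\chi_f$ leaves $\sigma_1(\alpha_i)$ unmatched; 2. every $X_{IJ}[g]$ admits a persistence basis, $\mathcal M_g$ is a partial matching between $\mathcal B(V)$ and $\mathcal B(U)$, and $\chi_f$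 is a representation of $\mathcal M_g$. -/

import Mathlib

open CategoryTheory
open scoped DirectSum

namespace PersMatch

universe u v

/-! ### Decorated endpoints and intervals of the real line -/

/-- Decorated endpoints: `-∞`, `∞` and, for every real `r`, the two points `r⁻ = (r, false)` and
`r⁺ = (r, true)`, with the lexicographic order (so `r⁻ < r⁺`). -/
abbrev Endpoint : Type := WithBot (WithTop (ℝ ×ₗ Bool))

/-- The decorated endpoint `r⁻`. -/
def Endpoint.minus (r : ℝ) : Endpoint := ((toLex (r, false) : ℝ ×ₗ Bool) : WithTop (ℝ ×ₗ Bool))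

/-- The decorated endpoint `r⁺`. -/
def Endpoint.plus (r : ℝ) : Endpoint := ((toLex (r, true) : ℝ ×ₗ Bool) : WithTop (ℝ ×ₗ Bool))

/-- The (nonempty) intervals `⟨a, b⟩` of `ℝ`, given by decorated endpoints `a < b`. -/
@[ext]
structure Interval where
  left : Endpoint
  right : Endpoint
  left_lt_right : left < right

/-- `t ∈ ⟨a, b⟩` means `a ≤ t⁻` and `t⁺ ≤ b`; e.g. `⟨r⁻, s⁺⟩ = [r, s]` and `⟨r⁺, s⁻⟩ = (r, s)`. -/
instance : Membership ℝ Interval where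
  mem I t := I.left ≤ Endpoint.minus t ∧ Endpoint.plus t ≤ I.right

theorem Endpoint.minus_mono {s t : ℝ} (h : s ≤ t) : Endpoint.minus s ≤ Endpoint.minus t := by
  simp only [Endpoint.minus, WithBot.coe_le_coe, WithTop.coe_le_coe]
  rw [Prod.Lex.le_iff]
  rcases h.lt_or_eq with h | h
  · exact Or.inl h
  · exact Or.inr ⟨h, le_refl _⟩

theorem Endpoint.plus_mono {s t : ℝ} (h : s ≤ t) : Endpoint.plus s ≤ Endpoint.plus t := by
  simp only [Endpoint.plus, WithBot.coe_le_coe, WithTop.coe_le_coe]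
  rw [Prod.Lex.le_iff]
  rcases h.lt_or_eq with h | h
  · exact Or.inl h
  · exact Or.inr ⟨h, le_refl _⟩

/-- A cut lies on one side of each point: either `c ≤ t⁻` or `t⁺ ≤ c`. -/
theorem Endpoint.le_minus_or_plus_le (c : Endpoint) (t : ℝ) :
    c ≤ Endpoint.minus t ∨ Endpoint.plus t ≤ c := by
  rcases lt_or_ge c (Endpoint.plus t) with h | h
  · left
    induction c using WithBot.recBotCoe with
    | bot => exact bot_le
    | coe c =>
      induction c using WithTop.recTopCoe with
      | top => simp [Endpoint.plus] at h
      | coe c =>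
        simp only [Endpoint.plus, WithBot.coe_lt_coe, WithTop.coe_lt_coe] at h
        simp only [Endpoint.minus, WithBot.coe_le_coe, WithTop.coe_le_coe]
        rw [Prod.Lex.lt_iff] at h
        rw [Prod.Lex.le_iff]
        rcases h with h | ⟨h, h'⟩
        · exact Or.inl h
        · refine Or.inr ⟨h, ?_⟩
          have h3 : (ofLex c).2 < true := h'
          show (ofLex c).2 ≤ false
          revert h3
          cases (ofLex c).2 <;> decide
  · exact Or.inr h

/-! ### Persistence modules, submodules and subquotients -/

/-- Persistence modules over the field `k`, indexed by `ℝ`. -/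
abbrev PersMod (k : Type u) [Field k] : Type (max u (v + 1)) := ℝ ⥤ ModuleCat.{v} k

variable {k : Type u} [Field k]

/-- The structure map `ρ_{st} : V(s) → V(t)` for `s ≤ t`. -/
def rho (V : PersMod.{u, v} k) {s t : ℝ} (h : s ≤ t) : V.obj s →ₗ[k] V.obj t :=
  (V.map (homOfLE h)).hom

theorem rho_self (V : PersMod.{u, v} k) {t : ℝ} (h : t ≤ t) (x : V.obj t) : rho V h x = x := by
  exact congrArg (fun φ => φ.hom x) (V.map_id t)

theorem rho_rho (V : PersMod.{u, v} k) {r s t : ℝ} (h : r ≤ s) (h' : s ≤ t) (x : V.obj r) :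
    rho V h' (rho V h x) = rho V (h.trans h') x := by
  exact congrArg (fun φ => φ.hom x) (V.map_comp (homOfLE h) (homOfLE h')).symm

theorem app_rho {V U : PersMod.{u, v} k} (f : V ⟶ U) {s t : ℝ} (h : s ≤ t) (x : V.obj s) :
    (f.app t).hom (rho V h x) = rho U h ((f.app s).hom x) := by
  exact congrArg (fun φ => φ.hom x) (f.naturality (homOfLE h))

/-- `V` is pointwise finite-dimensional. -/
def PointwiseFinite (V : PersMod.{u, v} k) : Prop := ∀ t : ℝ, FiniteDimensional k (V.obj t)

/-- A persistence submodule of `V`: a family of subspaces that is preserved by the structure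
maps. -/
structure Sub (V : PersMod.{u, v} k) where
  carrier : ∀ t : ℝ, Submodule k (V.obj t)
  map_mem : ∀ {s t : ℝ} (h : s ≤ t) (x : V.obj s), x ∈ carrier s → rho V h x ∈ carrier t

/-- The pointwise intersection of two persistence submodules. -/
def Sub.inter {V : PersMod.{u, v} k} (A B : Sub V) : Sub V where
  carrier t := A.carrier t ⊓ B.carrier t
  map_mem h x hx := ⟨A.map_mem h x hx.1, B.map_mem h x hx.2⟩

/-- The pointwise sum of two persistence submodules. -/
def Sub.sum {V : PersMod.{u, v} k} (A B : Sub V) : Sub V where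
  carrier t := A.carrier t ⊔ B.carrier t
  map_mem {s t} h x hx := by
    obtain ⟨y, hy, z, hz, rfl⟩ := Submodule.mem_sup.1 hx
    rw [map_add]
    exact Submodule.add_mem_sup (A.map_mem h y hy) (B.map_mem h z hz)

/-- The image of a persistence submodule under a morphism. -/
def Sub.map {V U : PersMod.{u, v} k} (f : V ⟶ U) (A : Sub V) : Sub U where
  carrier t := (A.carrier t).map (f.app t).hom
  map_mem {s t} h x hx := by
    obtain ⟨y, hy, rfl⟩ := hx
    exact ⟨rho V h y, A.map_mem h y hy, app_rho f h y⟩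

/-- The persistence submodule `A` of `V`, as a persistence module. -/
def Sub.toPersMod {V : PersMod.{u, v} k} (A : Sub V) : PersMod.{u, v} k where
  obj t := ModuleCat.of k (A.carrier t)
  map {s t} h := ModuleCat.ofHom
    ((rho V (leOfHom h)).restrict (p := A.carrier s) (q := A.carrier t) (A.map_mem (leOfHom h)))
  map_id t := by
    refine ModuleCat.hom_ext (LinearMap.ext fun x => ?_)
    exact Subtype.ext (rho_self V le_rfl x.1)
  map_comp {r s t} f g := by
    refine ModuleCat.hom_ext (LinearMap.ext fun x => ?_)
    exact Subtype.ext (rho_rho V (leOfHom f) (leOfHom g) x.1).symm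

/-- The subquotient `t ↦ A(t) / (B(t) ∩ A(t))` of `V`, as a persistence module. -/
def Sub.quotient {V : PersMod.{u, v} k} (A B : Sub V) : PersMod.{u, v} k where
  obj t := ModuleCat.of k
    (A.carrier t ⧸ (B.carrier t ⊓ A.carrier t).submoduleOf (A.carrier t))
  map {s t} h := ModuleCat.ofHom <|
    Submodule.mapQ _ _
      ((rho V (leOfHom h)).restrict (p := A.carrier s) (q := A.carrier t) (A.map_mem (leOfHom h)))
      (fun x hx => (B.inter A).map_mem (leOfHom h) x.1 hx)
  map_id t := by
    refine ModuleCat.hom_ext (LinearMap.ext fun x => ?_)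
    induction x using Submodule.Quotient.induction_on with
    | H x =>
      refine congrArg (Submodule.Quotient.mk (p := (B.carrier t ⊓ A.carrier t).submoduleOf _)) ?_
      exact Subtype.ext (rho_self V le_rfl x.1)
  map_comp {r s t} f g := by
    refine ModuleCat.hom_ext (LinearMap.ext fun x => ?_)
    induction x using Submodule.Quotient.induction_on with
    | H x =>
      refine congrArg (Submodule.Quotient.mk (p := (B.carrier t ⊓ A.carrier t).submoduleOf _)) ?_
      exact Subtype.ext (rho_rho V (leOfHom f) (leOfHom g) x.1).symm

/-- The image of a morphism `f : V → U`, as a persistence submodule of `U`. -/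
def imageSub {V U : PersMod.{u, v} k} (f : V ⟶ U) : Sub U where
  carrier t := LinearMap.range (f.app t).hom
  map_mem {s t} h x hx := by
    obtain ⟨y, rfl⟩ := hx
    exact ⟨rho V h y, app_rho f h y⟩

/-- The persistence module `Im f`. -/
def image {V U : PersMod.{u, v} k} (f : V ⟶ U) : PersMod.{u, v} k := (imageSub f).toPersMod

/-! ### Interval modules, persistence bases and barcodes -/

open Classical in
/-- The value at `t` of the interval module `k_I`: `k` if `t ∈ I`, and `0` otherwise. -/
noncomputable def intervalSpace (k : Type u) [Field k] (I : Interval) (t : ℝ) : Submodule k k :=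
  if t ∈ I then ⊤ else ⊥

open Classical in
/-- The linear map `k_I(s) → k_J(t)` that is the identity of `k` if `s ∈ I` and `t ∈ J`, and `0`
otherwise. For `I = J` and `s ≤ t` these are the structure maps of the interval module `k_I`; for
`s = t` this is the map `k_I(t) → k_J(t)` that is the identity if `t ∈ I ∩ J` and `0` otherwise. -/
noncomputable def intervalMap (k : Type u) [Field k] (I J : Interval) (s t : ℝ) :
    intervalSpace k I s →ₗ[k] intervalSpace k J t :=
  LinearMap.codRestrict (intervalSpace k J t)
    (if s ∈ I ∧ t ∈ J then (intervalSpace k I s).subtype else 0) (by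
      intro x
      by_cases h : s ∈ I ∧ t ∈ J
      · simp [intervalSpace, h.2]
      · simp [h])

/-- A persistence basis of `V`: an isomorphism of persistence modules `⨁ i, k_{I_i} ≅ V`, i.e. a
family of linear isomorphisms commuting with the structure maps. -/
structure PersistenceBasis (V : PersMod.{u, v} k) where
  ι : Type
  interval : ι → Interval
  equiv : ∀ t : ℝ, (⨁ i, intervalSpace k (interval i) t) ≃ₗ[k] V.obj t
  natural : ∀ {s t : ℝ} (h : s ≤ t) (x : ⨁ i, intervalSpace k (interval i) s),
    equiv t (DirectSum.lmap (fun i => intervalMap k (interval i) (interval i) s t) x) =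
      rho V h (equiv s x)

open Classical in
/-- The `i`-th persistence generator `k_{I_i} → V` of a persistence basis, at `t`. -/
noncomputable def PersistenceBasis.gen {V : PersMod.{u, v} k} (α : PersistenceBasis V) (i : α.ι)
    (t : ℝ) : intervalSpace k (α.interval i) t →ₗ[k] V.obj t :=
  (α.equiv t).toLinearMap ∘ₗ
    DirectSum.lof k α.ι (fun i => intervalSpace k (α.interval i) t) i

/-- `V` decomposes as a direct sum of interval modules. -/
def IsDecomposable (V : PersMod.{u, v} k) : Prop := Nonempty (PersistenceBasis V)

/-- A multiset of intervals, given by its multiplicity function; the underlying set `S` is the set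
of intervals of nonzero multiplicity. -/
abbrev Barcode : Type := Interval → ℕ∞

open Classical in
/-- The barcode of `V`: the multiplicity of `I` is the number of summands `k_I` in a decomposition
of `V` into interval modules (`0` by convention if `V` has no such decomposition). -/
noncomputable def barcode (V : PersMod.{u, v} k) : Barcode := fun I =>
  if h : Nonempty (PersistenceBasis V) then {i : h.some.ι | h.some.interval i = I}.encard else 0

/-- The representation `{I_l : 1 ≤ l ≤ m(I)}` of a barcode. -/
def Rep (m : Barcode) : Set (Interval × ℕ) := {x | 1 ≤ x.2 ∧ (x.2 : ℕ∞) ≤ m x.1}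

/-- A bijection between the generators of a persistence basis and the representation of the
barcode, which sends a generator with domain `k_I` to some `I_l`. -/
structure Labelling {V : PersMod.{u, v} k} (α : PersistenceBasis V) where
  toEquiv : α.ι ≃ Rep (barcode V)
  interval_eq : ∀ i, (toEquiv i).1.1 = α.interval i

/-! ### Partial matchings and their representations -/

/-- A partial matching between two barcodes, extended by `0` to all pairs of intervals: a function
with finite values whose row sums and column sums are bounded by the multiplicities. -/
def IsPartialMatching (m₁ m₂ : Barcode) (M : Interval → Interval → ℕ∞) : Prop :=
  (∀ I J, M I J ≠ ⊤) ∧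
  (∀ (I : Interval) (F : Finset Interval), ∑ J ∈ F, M I J ≤ m₁ I) ∧
  (∀ (J : Interval) (F : Finset Interval), ∑ I ∈ F, M I J ≤ m₂ J)

/-- A relation `R` between the representations of two barcodes is a representation of `M` if it is
(the graph of) an injective partial function and matches exactly `M I J` copies of `I` with copies
of `J`, for all `I` and `J`. -/
def IsRepresentation {m₁ m₂ : Barcode} (M : Interval → Interval → ℕ∞)
    (R : Rep m₁ → Rep m₂ → Prop) : Prop :=
  Relator.BiUnique R ∧
  ∀ I J, M I J = {x : Rep m₁ | x.1.1 = I ∧ ∃ y : Rep m₂, R x y ∧ y.1.1 = J}.encard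

/-! ### The Bauer-Lesnick matching -/

/-- The number of elements of `Rep m` that precede `x` among those with the same right endpoint,
where longer intervals come first and copies of an interval are ordered by their index. -/
noncomputable def rankRight {m : Barcode} (x : Rep m) : ℕ∞ :=
  {y : Rep m | y.1.1.right = x.1.1.right ∧
    (y.1.1.left < x.1.1.left ∨ y.1.1.left = x.1.1.left ∧ y.1.2 < x.1.2)}.encard

/-- The number of elements of `Rep m` that precede `x` among those with the same left endpoint,
where longer intervals come first and copies of an interval are ordered by their index. -/
noncomputable def rankLeft {m : Barcode} (x : Rep m) : ℕ∞ :=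
  {y : Rep m | y.1.1.left = x.1.1.left ∧
    (x.1.1.right < y.1.1.right ∨ y.1.1.right = x.1.1.right ∧ y.1.2 < x.1.2)}.encard

/-- The matching `ι` induced by an injective morphism between persistence modules with barcodes
`m₁` and `m₂`: for each `b`, the `i`-th interval of `m₁` ending at `b` is matched with the `i`-th
interval of `m₂` ending at `b`. -/
def matchInjective (m₁ m₂ : Barcode) (x : Rep m₁) (y : Rep m₂) : Prop :=
  x.1.1.right = y.1.1.right ∧ rankRight x = rankRight y

/-- The matching `λ` induced by a surjective morphism between persistence modules with barcodes
`m₁` and `m₂`: for each `a`, the `i`-th interval of `m₁` starting at `a` is matched with the `i`-th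
interval of `m₂` starting at `a`. -/
def matchSurjective (m₁ m₂ : Barcode) (x : Rep m₁) (y : Rep m₂) : Prop :=
  x.1.1.left = y.1.1.left ∧ rankLeft x = rankLeft y

/-- The Bauer-Lesnick matching `χ_f`, for the factorization `V → Im f → U` of `f`. -/
def chi {V U : PersMod.{u, v} k} (f : V ⟶ U) : Rep (barcode V) → Rep (barcode U) → Prop :=
  Relation.Comp (matchSurjective (barcode V) (barcode (image f)))
    (matchInjective (barcode (image f)) (barcode U))

/-! ### The induced partial matching -/

/-- `Im⁺_{ct}(V) = ⋂_{s ∈ ⟨c, t⁺⟩} Im ρ_{st}`. -/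
def imPlus (V : PersMod.{u, v} k) (c : Endpoint) (t : ℝ) : Submodule k (V.obj t) :=
  ⨅ (s : ℝ) (h : s ≤ t) (_ : c ≤ Endpoint.minus s), LinearMap.range (rho V h)

/-- `Im⁻_{ct}(V) = ⋃_{s ∈ ⟨-∞, c⟩} Im ρ_{st}` (an increasing union of subspaces). -/
def imMinus (V : PersMod.{u, v} k) (c : Endpoint) (t : ℝ) : Submodule k (V.obj t) :=
  ⨆ (s : ℝ) (h : s ≤ t) (_ : Endpoint.plus s ≤ c), LinearMap.range (rho V h)

/-- `Ker⁺_{ct}(V) = ⋂_{r ∈ ⟨c, ∞⟩} Ker ρ_{tr}`. -/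
def kerPlus (V : PersMod.{u, v} k) (c : Endpoint) (t : ℝ) : Submodule k (V.obj t) :=
  ⨅ (r : ℝ) (h : t ≤ r) (_ : c ≤ Endpoint.minus r), LinearMap.ker (rho V h)

/-- `Ker⁻_{ct}(V) = ⋃_{r ∈ ⟨t⁻, c⟩} Ker ρ_{tr}` (an increasing union of subspaces). -/
def kerMinus (V : PersMod.{u, v} k) (c : Endpoint) (t : ℝ) : Submodule k (V.obj t) :=
  ⨆ (r : ℝ) (h : t ≤ r) (_ : Endpoint.plus r ≤ c), LinearMap.ker (rho V h)

theorem imPlus_map (V : PersMod.{u, v} k) (c : Endpoint) {s t : ℝ} (h : s ≤ t) :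
    imPlus V c s ≤ (imPlus V c t).comap (rho V h) := by
  intro x hx
  simp only [imPlus, Submodule.mem_comap, Submodule.mem_iInf] at hx ⊢
  intro r hr hc
  rcases le_total r s with hrs | hrs
  · obtain ⟨y, rfl⟩ := hx r hrs hc
    exact ⟨y, (rho_rho V hrs h y).symm⟩
  · exact ⟨rho V hrs x, rho_rho V hrs hr x⟩

theorem imMinus_map (V : PersMod.{u, v} k) (c : Endpoint) {s t : ℝ} (h : s ≤ t) :
    imMinus V c s ≤ (imMinus V c t).comap (rho V h) := by
  refine iSup_le fun r => iSup_le fun hr => iSup_le fun hc => ?_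
  rintro _ ⟨y, rfl⟩
  have h1 : LinearMap.range (rho V (hr.trans h)) ≤ imMinus V c t :=
    le_iSup_of_le r (le_iSup_of_le (hr.trans h) (le_iSup_of_le hc le_rfl))
  exact h1 ⟨y, (rho_rho V hr h y).symm⟩

theorem kerPlus_map (V : PersMod.{u, v} k) (c : Endpoint) {s t : ℝ} (h : s ≤ t) :
    kerPlus V c s ≤ (kerPlus V c t).comap (rho V h) := by
  intro x hx
  simp only [kerPlus, Submodule.mem_comap, Submodule.mem_iInf, LinearMap.mem_ker] at hx ⊢
  intro r hr hc
  rw [rho_rho]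
  exact hx r (h.trans hr) hc

theorem kerMinus_map (V : PersMod.{u, v} k) (c : Endpoint) {s t : ℝ} (h : s ≤ t) :
    kerMinus V c s ≤ (kerMinus V c t).comap (rho V h) := by
  refine iSup_le fun r => iSup_le fun hr => iSup_le fun hc => ?_
  intro x hx
  rw [LinearMap.mem_ker] at hx
  rw [Submodule.mem_comap]
  rcases le_total t r with htr | htr
  · have h1 : LinearMap.ker (rho V htr) ≤ kerMinus V c t :=
      le_iSup_of_le r (le_iSup_of_le htr (le_iSup_of_le hc le_rfl))
    refine h1 ?_
    rw [LinearMap.mem_ker, rho_rho]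
    exact hx
  · rw [← rho_rho V hr htr, hx, map_zero]
    exact zero_mem _

theorem imMinus_le_imPlus (V : PersMod.{u, v} k) (c : Endpoint) (t : ℝ) :
    imMinus V c t ≤ imPlus V c t := by
  refine iSup_le fun r => iSup_le fun hr => iSup_le fun hc => ?_
  rintro _ ⟨y, rfl⟩
  simp only [imPlus, Submodule.mem_iInf]
  intro s hs hcs
  have hrs : r ≤ s := by
    by_contra hlt
    have h1 : Endpoint.plus r ≤ Endpoint.minus s := hc.trans hcs
    simp only [Endpoint.plus, Endpoint.minus, WithBot.coe_le_coe, WithTop.coe_le_coe] at h1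
    rw [Prod.Lex.le_iff] at h1
    rcases h1 with h1 | ⟨h1, _⟩
    · exact hlt (le_of_lt h1)
    · exact hlt (le_of_eq h1)
  exact ⟨rho V hrs y, rho_rho V hrs hs y⟩

theorem kerMinus_le_kerPlus (V : PersMod.{u, v} k) (c : Endpoint) (t : ℝ) :
    kerMinus V c t ≤ kerPlus V c t := by
  refine iSup_le fun r => iSup_le fun hr => iSup_le fun hc => ?_
  intro x hx
  rw [LinearMap.mem_ker] at hx
  simp only [kerPlus, Submodule.mem_iInf, LinearMap.mem_ker]
  intro s hs hcs
  have hrs : r ≤ s := by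
    by_contra hlt
    have h1 : Endpoint.plus r ≤ Endpoint.minus s := hc.trans hcs
    simp only [Endpoint.plus, Endpoint.minus, WithBot.coe_le_coe, WithTop.coe_le_coe] at h1
    rw [Prod.Lex.le_iff] at h1
    rcases h1 with h1 | ⟨h1, _⟩
    · exact hlt (le_of_lt h1)
    · exact hlt (le_of_eq h1)
  rw [← rho_rho V hr hrs, hx, map_zero]

/-- An element of `Ker⁺_{bs}` dies on leaving an interval with right endpoint `b`. -/
theorem rho_eq_zero_of_kerPlus (V : PersMod.{u, v} k) (I : Interval) {s t : ℝ} (h : s ≤ t)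
    (hs : s ∈ I) (ht : t ∉ I) {x : V.obj s} (hx : x ∈ kerPlus V I.right s) : rho V h x = 0 := by
  simp only [kerPlus, Submodule.mem_iInf, LinearMap.mem_ker] at hx
  refine hx t h ?_
  rcases Endpoint.le_minus_or_plus_le I.right t with h1 | h1
  · exact h1
  · exact absurd ⟨hs.1.trans (Endpoint.minus_mono h), h1⟩ ht

open Classical in
/-- The persistence submodule `V⁺_I`, with
`V⁺_{It} = Im⁺_{at} ∩ Ker⁺_{bt}` for `t ∈ I = ⟨a, b⟩` and `V⁺_{It} = 0` for `t ∉ I`. -/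
noncomputable def plusSub (V : PersMod.{u, v} k) (I : Interval) : Sub V where
  carrier t := if t ∈ I then imPlus V I.left t ⊓ kerPlus V I.right t else ⊥
  map_mem {s t} h x hx := by
    by_cases hs : s ∈ I
    · rw [if_pos hs] at hx
      by_cases ht : t ∈ I
      · rw [if_pos ht]
        exact ⟨imPlus_map V _ h hx.1, kerPlus_map V _ h hx.2⟩
      · rw [rho_eq_zero_of_kerPlus V I h hs ht hx.2]
        exact zero_mem _
    · rw [if_neg hs, Submodule.mem_bot] at hx
      rw [hx, map_zero]
      exact zero_mem _

open Classical in
/-- The persistence submodule `V⁻_I`, with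
`V⁻_{It} = Im⁻_{at} ∩ Ker⁺_{bt} + Im⁺_{at} ∩ Ker⁻_{bt}` for `t ∈ I = ⟨a, b⟩` and
`V⁻_{It} = 0` for `t ∉ I`. -/
noncomputable def minusSub (V : PersMod.{u, v} k) (I : Interval) : Sub V where
  carrier t := if t ∈ I then
    (imMinus V I.left t ⊓ kerPlus V I.right t) ⊔ (imPlus V I.left t ⊓ kerMinus V I.right t) else ⊥
  map_mem {s t} h x hx := by
    by_cases hs : s ∈ I
    · rw [if_pos hs] at hx
      by_cases ht : t ∈ I
      · rw [if_pos ht]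
        obtain ⟨y, hy, z, hz, rfl⟩ := Submodule.mem_sup.1 hx
        rw [map_add]
        exact Submodule.add_mem_sup ⟨imMinus_map V _ h hy.1, kerPlus_map V _ h hy.2⟩
          ⟨imPlus_map V _ h hz.1, kerMinus_map V _ h hz.2⟩
      · have hx' : x ∈ kerPlus V I.right s :=
          (sup_le inf_le_right (inf_le_right.trans (kerMinus_le_kerPlus V _ _)) :
            _ ≤ kerPlus V I.right s) hx
        rw [rho_eq_zero_of_kerPlus V I h hs ht hx']
        exact zero_mem _
    · rw [if_neg hs, Submodule.mem_bot] at hx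
      rw [hx, map_zero]
      exact zero_mem _

/-- `Y⁺_{IJ}[f](t) = f(V⁺_{It}) ∩ U⁺_{Jt}`. -/
noncomputable def yPlus {V U : PersMod.{u, v} k} (f : V ⟶ U) (I J : Interval) : Sub U :=
  ((plusSub V I).map f).inter (plusSub U J)

/-- `Y⁻_{IJ}[f](t) = f(V⁻_{It}) + U⁻_{Jt}`. -/
noncomputable def yMinus {V U : PersMod.{u, v} k} (f : V ⟶ U) (I J : Interval) : Sub U :=
  ((minusSub V I).map f).sum (minusSub U J)

/-- The persistence module `X_{IJ}[f] = Y⁺_{IJ}[f] / (Y⁻_{IJ}[f] ∩ Y⁺_{IJ}[f])`. -/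
noncomputable def xMod {V U : PersMod.{u, v} k} (f : V ⟶ U) (I J : Interval) : PersMod.{u, v} k :=
  (yPlus f I J).quotient (yMinus f I J)

/-- The persistence partial matching `𝓖_f(I, J) = 𝓑(X_{IJ}[f])`. -/
noncomputable def inducedBarcode {V U : PersMod.{u, v} k} (f : V ⟶ U) (I J : Interval) : Barcode :=
  barcode (xMod f I J)

/-- The induced partial matching `𝓜_f(I, J) = #𝓑(X_{IJ}[f])`, the number of intervals counted with
multiplicity. -/
noncomputable def inducedMatching {V U : PersMod.{u, v} k} (f : V ⟶ U) (I J : Interval) : ℕ∞ :=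
  (Rep (inducedBarcode f I J)).encard

end PersMatch

/-! The morphism g sends each generator to its partner under χ_f, or to 0. A nonzero map k_I → k_J
of the prescribed form is natural when J starts and ends no later than I. The proof therefore has to
show this for the pairs matched by χ_f and then compute X_{IJ}[g].

The inequalities come from counting. Let a < b and choose t with t ∈ ⟨a, b⟩. The number of bars
ending at b and starting no later than a is the codimension of Im⁺_a ∩ Ker⁻_b in Im⁺_a ∩ Ker⁺_b at
t, and an injective morphism induces an injection of these quotients. The number of bars starting at
a and ending no earlier than b is the codimension of Im⁻_a + Im⁺_a ∩ Ker⁻_b in Im⁺_a, and a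
surjective morphism induces a surjection of these quotients. Hence such counts can only grow along
an injection and only shrink along a surjection (`IsFrame.encard_le_of_injective`,
`IsFrame.encard_le_of_surjective`). Comparing ranks, ι moves left endpoints to the left and λ moves
right endpoints to the left. A pair (I, J) matched by χ_f passes through the bar ⟨I.left, J.right⟩
of Im f, so I ∩ J is moreover nonempty (`left_right_le_of_chi`).

The rest is linear algebra in coordinates. In any interval basis, the subspaces V^±_{It} are spanned
by basis vectors (`IsFrame.plusSub_eq`, `IsFrame.minusSub_eq`). Since g comes from an injective
partial function on generators, Y^± are also spanned by basis vectors, and the surviving classes in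
X_{IJ}(t) are those of the matched pairs (copy of I, copy of J), each living on I ∩ J
(`exists_isFrame_xMod`). So 𝓜_g counts the pairs of χ_f.

Existence of interval bases is Crawley-Boevey's theorem (`exists_isFrame`): sections k_I → V⁺_I
lifting a basis of V⁺_I / V⁻_I, taken over all I, form a basis. The multiplicity of I is the
dimension of that quotient, hence independent of the basis (`IsFrame.encard_eq_encard`). -/

namespace PersMatch

universe u v w

/-! ### Endpoints -/

namespace Endpoint

theorem eq_bot_or_top_or_minus_or_plus (c : Endpoint) :
    c = ⊥ ∨ c = ⊤ ∨ (∃ r, c = minus r) ∨ ∃ r, c = plus r := by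
  induction c using WithBot.recBotCoe with
  | bot => exact Or.inl rfl
  | coe c =>
    induction c using WithTop.recTopCoe with
    | top => exact Or.inr (Or.inl rfl)
    | coe c =>
      obtain ⟨r, d⟩ := c
      cases d
      · exact Or.inr (Or.inr (Or.inl ⟨r, rfl⟩))
      · exact Or.inr (Or.inr (Or.inr ⟨r, rfl⟩))

theorem minus_le_minus {s t : ℝ} : minus s ≤ minus t ↔ s ≤ t := by
  simp only [minus, WithBot.coe_le_coe, WithTop.coe_le_coe]
  rw [Prod.Lex.le_iff]
  simp [le_iff_lt_or_eq]

theorem plus_le_plus {s t : ℝ} : plus s ≤ plus t ↔ s ≤ t := by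
  simp only [plus, WithBot.coe_le_coe, WithTop.coe_le_coe]
  rw [Prod.Lex.le_iff]
  simp [le_iff_lt_or_eq]

theorem plus_le_minus {s t : ℝ} : plus s ≤ minus t ↔ s < t := by
  simp only [plus, minus, WithBot.coe_le_coe, WithTop.coe_le_coe]
  rw [Prod.Lex.le_iff]
  simp

theorem minus_lt_plus (t : ℝ) : minus t < plus t :=
  lt_of_not_ge fun h => lt_irrefl t (plus_le_minus.1 h)

theorem minus_lt_top (t : ℝ) : minus t < ⊤ :=
  (minus_lt_plus t).trans_le le_top

theorem not_le_minus {c : Endpoint} {t : ℝ} : ¬ c ≤ minus t ↔ plus t ≤ c :=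
  ⟨fun h => (le_minus_or_plus_le c t).resolve_left h,
    fun h h' => absurd (h.trans h') (minus_lt_plus t).not_ge⟩

theorem not_plus_le {c : Endpoint} {t : ℝ} : ¬ plus t ≤ c ↔ c ≤ minus t := by
  rw [← not_le_minus, not_not]

/-- Between two different endpoints there is a real number. -/
theorem exists_between {a b : Endpoint} (h : a < b) : ∃ t, a ≤ minus t ∧ plus t ≤ b := by
  obtain rfl | rfl | ⟨r, rfl⟩ | ⟨r, rfl⟩ := a.eq_bot_or_top_or_minus_or_plus
  · obtain rfl | rfl | ⟨s, rfl⟩ | ⟨s, rfl⟩ := b.eq_bot_or_top_or_minus_or_plus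
    · exact absurd h (lt_irrefl _)
    · exact ⟨0, bot_le, le_top⟩
    · exact ⟨s - 1, bot_le, plus_le_minus.2 (by linarith)⟩
    · exact ⟨s, bot_le, le_rfl⟩
  · exact absurd h le_top.not_gt
  · exact ⟨r, le_rfl, not_le_minus.1 h.not_ge⟩
  · obtain rfl | rfl | ⟨s, rfl⟩ | ⟨s, rfl⟩ := b.eq_bot_or_top_or_minus_or_plus
    · exact absurd h bot_le.not_gt
    · exact ⟨r + 1, plus_le_minus.2 (by linarith), le_top⟩
    · have := plus_le_minus.1 h.le
      obtain ⟨t, h1, h2⟩ := _root_.exists_between this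
      exact ⟨t, plus_le_minus.2 h1, plus_le_minus.2 h2⟩
    · have : r < s := lt_of_not_ge fun h' => h.not_ge (plus_le_plus.2 h')
      exact ⟨s, plus_le_minus.2 this, le_rfl⟩

/-- A real number separates any two distinct endpoints, so an endpoint is determined by the reals
above it. This turns the intersections defining Im⁺ and Ker⁺ into inequalities between endpoints. -/
theorem le_iff_forall_le_minus {a b : Endpoint} : a ≤ b ↔ ∀ t, b ≤ minus t → a ≤ minus t := by
  refine ⟨fun h t ht => h.trans ht, fun h => le_of_not_gt fun hlt => ?_⟩
  obtain ⟨t, h1, h2⟩ := exists_between hlt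
  exact not_le_minus.2 h2 (h t h1)

/-- Every upper set of real numbers is given by an endpoint. -/
theorem exists_cut {S : Set ℝ} (hS : IsUpperSet S) : ∃ c : Endpoint, ∀ s, s ∈ S ↔ c ≤ minus s := by
  rcases S.eq_empty_or_nonempty with rfl | hne
  · exact ⟨⊤, fun s => ⟨fun h => h.elim, fun h => absurd h (minus_lt_top s).not_ge⟩⟩
  by_cases hb : BddBelow S
  -- The decoration of the cut records whether the infimum is attained.
  · by_cases hr : sInf S ∈ S
    · refine ⟨minus (sInf S), fun s => ?_⟩
      rw [minus_le_minus]
      exact ⟨fun hs => csInf_le hb hs, fun hs => hS hs hr⟩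
    · refine ⟨plus (sInf S), fun s => ?_⟩
      rw [plus_le_minus]
      refine ⟨fun hs => lt_of_le_of_ne (csInf_le hb hs) fun h => hr (h ▸ hs), fun hs => ?_⟩
      obtain ⟨x, hx, hxs⟩ := exists_lt_of_csInf_lt hne hs
      exact hS hxs.le hx
  · refine ⟨⊥, fun s => ⟨fun _ => bot_le, fun _ => ?_⟩⟩
    obtain ⟨x, hx, hxs⟩ := not_bddBelow_iff.1 hb s
    exact hS hxs.le hx

/-- The real numbers above an endpoint have a coinitial sequence. -/
theorem exists_coinitial_seq {c : Endpoint} {t : ℝ} (h : c ≤ minus t) :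
    ∃ s : ℕ → ℝ, Antitone s ∧ s 0 = t ∧ (∀ n, c ≤ minus (s n)) ∧
      ∀ r, c ≤ minus r → ∃ n, s n ≤ r := by
  obtain rfl | rfl | ⟨q, rfl⟩ | ⟨q, rfl⟩ := c.eq_bot_or_top_or_minus_or_plus
  · refine ⟨fun n => t - n, fun m n hmn => ?_, by simp, fun _ => bot_le, fun r _ => ?_⟩
    · have : (m : ℝ) ≤ n := Nat.cast_le.2 hmn
      simp only
      linarith
    · obtain ⟨n, hn⟩ := exists_nat_ge (t - r)
      exact ⟨n, by linarith⟩
  · exact absurd h (minus_lt_top t).not_ge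
  · have hq := minus_le_minus.1 h
    refine ⟨fun n => if n = 0 then t else q, fun m n hmn => ?_, by simp, fun n => ?_,
      fun r hr => ⟨1, by simpa using minus_le_minus.1 hr⟩⟩
    · rcases Nat.eq_zero_or_pos m with rfl | hm
      · by_cases hn : n = 0 <;> simp [hn, hq]
      · simp [hm.ne', (hm.trans_le hmn).ne']
    · by_cases hn : n = 0 <;> simp [hn, h]
  · have hq := plus_le_minus.1 h
    refine ⟨fun n => q + (t - q) / (n + 1), fun m n hmn => ?_, by simp, fun n => ?_, fun r hr => ?_⟩
    · have : (m : ℝ) ≤ n := Nat.cast_le.2 hmn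
      have h' : 0 ≤ t - q := by linarith
      simp only
      gcongr
    · rw [plus_le_minus]
      have : 0 < (t - q) / ((n : ℝ) + 1) := div_pos (by linarith) (by positivity)
      linarith
    · have hr := plus_le_minus.1 hr
      obtain ⟨n, hn⟩ := exists_nat_ge ((t - q) / (r - q))
      refine ⟨n, ?_⟩
      have h1 : 0 < r - q := by linarith
      rw [div_le_iff₀ h1] at hn
      have : (t - q) / ((n : ℝ) + 1) ≤ r - q := by
        rw [div_le_iff₀ (by positivity)]
        nlinarith
      linarith

end Endpoint

theorem Interval.mem_def {I : Interval} {t : ℝ} :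
    t ∈ I ↔ I.left ≤ Endpoint.minus t ∧ Endpoint.plus t ≤ I.right := Iff.rfl

theorem Interval.nonempty (I : Interval) : ∃ t, t ∈ I := Endpoint.exists_between I.left_lt_right

theorem Interval.not_mem_iff {I : Interval} {s t : ℝ} (h : s ≤ t) (hs : s ∈ I) :
    t ∉ I ↔ I.right ≤ Endpoint.minus t := by
  rw [← Endpoint.not_plus_le, Interval.mem_def, not_and]
  exact ⟨fun h' => h' (hs.1.trans (Endpoint.minus_mono h)), fun h' _ => h'⟩

theorem Interval.mem_iff_of_le {I : Interval} {s t : ℝ} (h : s ≤ t) (ht : t ∈ I) :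
    s ∈ I ↔ I.left ≤ Endpoint.minus s :=
  ⟨fun h' => h'.1, fun h' => ⟨h', (Endpoint.plus_mono h).trans ht.2⟩⟩

variable {k : Type u} [Field k]

/-! ### Families of generators -/

/-- A family of vectors `w i t ∈ V(t)`, compatible with the structure maps on the intervals `K i`
and vanishing outside, that is a basis of `V(t)` for each `t`. -/
structure IsFrame (V : PersMod.{u, v} k) {ι : Type w} (K : ι → Interval)
    (w : ι → ∀ t : ℝ, V.obj t) : Prop where
  eq_zero : ∀ i t, t ∉ K i → w i t = 0
  rho_eq : ∀ i {s t : ℝ} (h : s ≤ t), s ∈ K i → rho V h (w i s) = w i t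
  linearIndepOn : ∀ t, LinearIndepOn k (fun i => w i t) {i | t ∈ K i}
  span_eq : ∀ t, Submodule.span k (Set.range fun i => w i t) = ⊤

open Classical in
/-- The generator of `k_I(t)`. -/
noncomputable def intervalGen (k : Type u) [Field k] (I : Interval) (t : ℝ) :
    intervalSpace k I t :=
  ⟨if t ∈ I then 1 else 0, by
    unfold intervalSpace
    split_ifs
    exacts [Submodule.mem_top, zero_mem _]⟩

theorem intervalGen_of_mem {I : Interval} {t : ℝ} (h : t ∈ I) : (intervalGen k I t : k) = 1 :=
  if_pos h

theorem intervalGen_of_not_mem {I : Interval} {t : ℝ} (h : t ∉ I) : intervalGen k I t = 0 :=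
  Subtype.ext (if_neg h)

theorem intervalSpace_eq_zero {I : Interval} {t : ℝ} (h : t ∉ I) (x : intervalSpace k I t) :
    x = 0 := by
  obtain ⟨x, hx⟩ := x
  simp only [intervalSpace, if_neg h, Submodule.mem_bot] at hx
  exact Subtype.ext hx

theorem eq_smul_intervalGen {I : Interval} {t : ℝ} (x : intervalSpace k I t) :
    x = (x : k) • intervalGen k I t := by
  by_cases h : t ∈ I
  · exact Subtype.ext (by simp [intervalGen_of_mem h])
  · rw [intervalSpace_eq_zero h x]; simp

theorem intervalMap_intervalGen {I J : Interval} {s t : ℝ} (hs : s ∈ I) :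
    intervalMap k I J s t (intervalGen k I s) = intervalGen k J t := by
  refine Subtype.ext ?_
  by_cases ht : t ∈ J
  · simp [intervalMap, hs, ht, intervalGen_of_mem]
  · simp [intervalMap, ht, intervalGen_of_not_mem]

namespace PersistenceBasis

variable {V : PersMod.{u, v} k} (α : PersistenceBasis V)

/-- The vectors given by the generators of a persistence basis. -/
noncomputable def vec (i : α.ι) (t : ℝ) : V.obj t := α.gen i t (intervalGen k (α.interval i) t)

theorem gen_apply (i : α.ι) (t : ℝ) (x : intervalSpace k (α.interval i) t) :
    α.gen i t x = (x : k) • α.vec i t := by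
  conv_lhs => rw [eq_smul_intervalGen x, map_smul]
  rfl

theorem isFrame : IsFrame V α.interval α.vec where
  eq_zero i t h := by rw [vec, intervalGen_of_not_mem h, map_zero]
  rho_eq i {s t} h hs := by
    simp only [vec, gen, LinearMap.comp_apply, LinearEquiv.coe_coe]
    rw [← α.natural, DirectSum.lmap_lof, intervalMap_intervalGen hs]
  linearIndepOn t := by
    classical
    rw [linearIndepOn_iff]
    intro l hl h0
    have h1 : (α.equiv t) (l.sum fun i c => c • DirectSum.lof k α.ι
        (fun i => intervalSpace k (α.interval i) t) i (intervalGen k _ t)) = 0 := by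
      rw [← h0, Finsupp.linearCombination_apply, Finsupp.sum, Finsupp.sum, map_sum]
      refine Finset.sum_congr rfl fun i _ => ?_
      rw [map_smul]
      simp only [vec, gen, LinearMap.comp_apply, LinearEquiv.coe_coe]
    rw [LinearEquiv.map_eq_zero_iff] at h1
    ext i
    by_cases hi : i ∈ l.support
    · have hit : t ∈ α.interval i := hl hi
      have h2 := congrArg (fun x => ((DirectSum.component k α.ι
        (fun i => intervalSpace k (α.interval i) t) i x : _) : k)) h1
      simp only [Finsupp.sum, map_sum, map_smul, DirectSum.component.of, map_zero] at h2
      rw [Finset.sum_eq_single i] at h2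
      · simpa [intervalGen_of_mem hit] using h2
      · intro j _ hj
        simp [hj]
      · intro h; exact absurd hi h
    · simpa using hi
  span_eq t := by
    classical
    refine eq_top_iff.2 fun v _ => ?_
    obtain ⟨x, rfl⟩ := (α.equiv t).surjective v
    induction x using DirectSum.induction_on with
    | zero => simp
    | of i x =>
      have : α.equiv t (DirectSum.of (fun i => intervalSpace k (α.interval i) t) i x) =
          α.gen i t x := by
        simp only [gen, LinearMap.comp_apply, LinearEquiv.coe_coe]
        rw [DirectSum.lof_eq_of]
      rw [this, gen_apply]
      exact Submodule.smul_mem _ _ (Submodule.subset_span ⟨i, rfl⟩)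
    | add x y hx hy =>
      rw [map_add]
      exact Submodule.add_mem _ (hx trivial) (hy trivial)

end PersistenceBasis

/-- The persistence basis given by a family of generators. -/
noncomputable def IsFrame.toBasis {V : PersMod.{u, v} k} {ι : Type} {K : ι → Interval}
    {w : ι → ∀ t : ℝ, V.obj t} (hw : IsFrame V K w) : PersistenceBasis V := by
  classical
  let φ (t : ℝ) : (⨁ i, intervalSpace k (K i) t) →ₗ[k] V.obj t :=
    DirectSum.toModule k ι _ fun i =>
      (LinearMap.toSpanSingleton k (V.obj t) (w i t)) ∘ₗ (intervalSpace k (K i) t).subtype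
  have hφ (t : ℝ) (i : ι) (x : intervalSpace k (K i) t) :
      φ t (DirectSum.lof k ι (fun i => intervalSpace k (K i) t) i x) = (x : k) • w i t := by
    simp [φ, DirectSum.toModule_lof]
  have hbij (t : ℝ) : Function.Bijective (φ t) := by
    constructor
    · rw [injective_iff_map_eq_zero]
      intro x hx
      have h1 : φ t x = ∑ i ∈ DFinsupp.support x, ((x i : k)) • w i t := by
        conv_lhs => rw [← DirectSum.sum_support_of x]
        rw [map_sum]
        exact Finset.sum_congr rfl fun i _ => hφ t i (x i)
      rw [h1] at hx
      let l : ι →₀ k := Finsupp.onFinset (DFinsupp.support x) (fun i => (x i : k)) (by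
        intro i hi
        rw [DFinsupp.mem_support_iff]
        intro h0
        apply hi
        have h2 : x i = 0 := h0
        rw [h2]; rfl)
      have hl : l ∈ Finsupp.supported k k {i | t ∈ K i} := by
        intro i hi
        by_contra hit
        have : l i ≠ 0 := by simpa using hi
        exact this (congrArg Subtype.val (intervalSpace_eq_zero hit (x i)))
      have h3 : Finsupp.linearCombination k (fun i => w i t) l = 0 := by
        rw [Finsupp.linearCombination_apply]
        exact (Finsupp.onFinset_sum (g := fun i a => a • w i t) _ (fun i => zero_smul k _)).trans hx
      have h4 := linearIndepOn_iff.1 (hw.linearIndepOn t) l hl h3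
      refine DFinsupp.ext fun i => Subtype.ext ?_
      exact DFunLike.congr_fun h4 i
    · rw [← LinearMap.range_eq_top, eq_top_iff, ← hw.span_eq t, Submodule.span_le]
      rintro _ ⟨i, rfl⟩
      by_cases hi : t ∈ K i
      · exact ⟨_, (hφ t i (intervalGen k _ t)).trans (by rw [intervalGen_of_mem hi, one_smul])⟩
      · simp only [hw.eq_zero i t hi]; exact zero_mem _
  exact
    { ι := ι
      interval := K
      equiv := fun t => LinearEquiv.ofBijective (φ t) (hbij t)
      natural := by
        intro s t h x
        simp only [LinearEquiv.ofBijective_apply]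
        induction x using DirectSum.induction_on with
        | zero => simp
        | of i x =>
          rw [← DirectSum.lof_eq_of k, DirectSum.lmap_lof, hφ, hφ, map_smul]
          by_cases hs : s ∈ K i
          · rw [hw.rho_eq i h hs]
            conv_lhs => rw [eq_smul_intervalGen x, map_smul, intervalMap_intervalGen hs]
            by_cases ht : t ∈ K i
            · simp [intervalGen_of_mem ht]
            · simp [hw.eq_zero i t ht]
          · rw [intervalSpace_eq_zero hs x]; simp
        | add x y hx hy => simp only [map_add, hx, hy] }

/-! ### Images and kernels of the structure maps -/

/-- In a chain, a minimal member is the least one, and finite dimension provides a minimal member.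
Thus the intersections defining Im⁺ and Ker⁺ are attained at a single index whenever they range over
a nonempty index set. -/
theorem exists_forall_le_of_monotone {E X : Type*} [AddCommGroup E] [Module k E]
    [FiniteDimensional k E] [LinearOrder X] [Nonempty X] {Φ : X → Submodule k E}
    (hΦ : Monotone Φ) : ∃ x, ∀ y, Φ x ≤ Φ y := by
  obtain ⟨_, ⟨x, rfl⟩, hx⟩ := IsArtinian.set_has_minimal (Set.range Φ) (Set.range_nonempty Φ)
  refine ⟨x, fun y => ?_⟩
  rcases le_total x y with h | h
  · exact hΦ h
  · exact (eq_of_le_of_not_lt (hΦ h) (hx _ ⟨y, rfl⟩)).ge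

section

variable (V : PersMod.{u, v} k)

theorem range_rho_mono {r s t : ℝ} (hrs : r ≤ s) (hst : s ≤ t) :
    LinearMap.range (rho V (hrs.trans hst)) ≤ LinearMap.range (rho V hst) := by
  rintro _ ⟨x, rfl⟩
  exact ⟨rho V hrs x, rho_rho V hrs hst x⟩

theorem ker_rho_mono {r s t : ℝ} (hrs : r ≤ s) (hst : s ≤ t) :
    LinearMap.ker (rho V hrs) ≤ LinearMap.ker (rho V (hrs.trans hst)) := by
  intro x hx
  rw [LinearMap.mem_ker] at hx ⊢
  rw [← rho_rho V hrs hst, hx, map_zero]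

variable {V}

theorem imPlus_le_range {c : Endpoint} {s t : ℝ} (h : s ≤ t) (hc : c ≤ Endpoint.minus s) :
    imPlus V c t ≤ LinearMap.range (rho V h) :=
  iInf_le_of_le s (iInf_le_of_le h (iInf_le_of_le hc le_rfl))

theorem range_le_imMinus {c : Endpoint} {s t : ℝ} (h : s ≤ t) (hc : Endpoint.plus s ≤ c) :
    LinearMap.range (rho V h) ≤ imMinus V c t :=
  le_iSup_of_le s (le_iSup_of_le h (le_iSup_of_le hc le_rfl))

theorem kerPlus_le_ker {c : Endpoint} {t r : ℝ} (h : t ≤ r) (hc : c ≤ Endpoint.minus r) :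
    kerPlus V c t ≤ LinearMap.ker (rho V h) :=
  iInf_le_of_le r (iInf_le_of_le h (iInf_le_of_le hc le_rfl))

theorem ker_le_kerMinus {c : Endpoint} {t r : ℝ} (h : t ≤ r) (hc : Endpoint.plus r ≤ c) :
    LinearMap.ker (rho V h) ≤ kerMinus V c t :=
  le_iSup_of_le r (le_iSup_of_le h (le_iSup_of_le hc le_rfl))

/-- A real s between a and b gives the single image Im ρ_{st} lying between the two subspaces.
Together with the analogue for kernels, this makes the contributions of different intervals
triangular in `exists_isFrame`. -/
theorem imPlus_le_imMinus {a b : Endpoint} (h : a < b) {t : ℝ} (hb : b ≤ Endpoint.minus t) :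
    imPlus V a t ≤ imMinus V b t := by
  obtain ⟨s, h1, h2⟩ := Endpoint.exists_between h
  have hs : s ≤ t := (Endpoint.plus_le_minus.1 (h2.trans hb)).le
  exact (imPlus_le_range hs h1).trans (range_le_imMinus hs h2)

theorem kerPlus_le_kerMinus {a b : Endpoint} (h : a < b) {t : ℝ} (ha : Endpoint.plus t ≤ a) :
    kerPlus V a t ≤ kerMinus V b t := by
  obtain ⟨s, h1, h2⟩ := Endpoint.exists_between h
  have hs : t ≤ s := (Endpoint.plus_le_minus.1 (ha.trans h1)).le
  exact (kerPlus_le_ker hs h1).trans (ker_le_kerMinus hs h2)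

theorem exists_imPlus_eq (hV : PointwiseFinite V) {c : Endpoint} {t : ℝ}
    (hc : c ≤ Endpoint.minus t) : ∃ (s : ℝ) (h : s ≤ t), c ≤ Endpoint.minus s ∧
      imPlus V c t = LinearMap.range (rho V h) := by
  have := hV t
  let X := {s : ℝ // s ≤ t ∧ c ≤ Endpoint.minus s}
  have : Nonempty X := ⟨⟨t, le_rfl, hc⟩⟩
  obtain ⟨⟨s, h, hs⟩, hmin⟩ := exists_forall_le_of_monotone
    (Φ := fun s : X => LinearMap.range (rho V s.2.1)) (fun a b hab => range_rho_mono V hab b.2.1)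
  exact ⟨s, h, hs, le_antisymm (imPlus_le_range h hs)
    (le_iInf fun r => le_iInf fun hr => le_iInf fun hcr => hmin ⟨r, hr, hcr⟩)⟩

theorem mem_kerMinus {c : Endpoint} {t : ℝ} (hc : Endpoint.plus t ≤ c) {x : V.obj t} :
    x ∈ kerMinus V c t ↔ ∃ (r : ℝ) (h : t ≤ r), Endpoint.plus r ≤ c ∧ rho V h x = 0 := by
  constructor
  · intro hx
    let X := {r : ℝ // t ≤ r ∧ Endpoint.plus r ≤ c}
    have : Nonempty X := ⟨⟨t, le_rfl, hc⟩⟩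
    have hmono : Monotone (fun r : X => LinearMap.ker (rho V r.2.1)) :=
      fun a b hab => ker_rho_mono V a.2.1 hab
    have h1 : kerMinus V c t ≤ ⨆ r : X, LinearMap.ker (rho V r.2.1) :=
      iSup_le fun r => iSup_le fun hr => iSup_le fun hcr =>
        le_iSup (fun r : X => LinearMap.ker (rho V r.2.1)) ⟨r, hr, hcr⟩
    obtain ⟨⟨r, hr, hcr⟩, hx⟩ :=
      (Submodule.mem_iSup_of_directed _ hmono.directed_le).1 (h1 hx)
    exact ⟨r, hr, hcr, hx⟩
  · rintro ⟨r, hr, hcr, hx⟩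
    exact ker_le_kerMinus hr hcr hx

theorem imMinus_le_map {c : Endpoint} {s t : ℝ} (h : s ≤ t) (hc : c ≤ Endpoint.minus s) :
    imMinus V c t ≤ (imMinus V c s).map (rho V h) := by
  refine iSup_le fun r => iSup_le fun hr => iSup_le fun hcr => ?_
  rintro _ ⟨x, rfl⟩
  have hrs : r ≤ s := (Endpoint.plus_le_minus.1 (hcr.trans hc)).le
  exact ⟨rho V hrs x, range_le_imMinus hrs hcr ⟨x, rfl⟩, rho_rho V hrs h x⟩

/-- Lifting through an infinite intersection is possible because Im⁺ at s is a single image Im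
ρ_{rs}: an element that comes from r has a preimage at s which also comes from r. -/
theorem imPlus_le_map (hV : PointwiseFinite V) {c : Endpoint} {s t : ℝ} (h : s ≤ t)
    (hc : c ≤ Endpoint.minus s) : imPlus V c t ≤ (imPlus V c s).map (rho V h) := by
  obtain ⟨r, hr, hcr, heq⟩ := exists_imPlus_eq hV hc
  intro x hx
  obtain ⟨y, rfl⟩ := imPlus_le_range (hr.trans h) hcr hx
  exact ⟨rho V hr y, heq ▸ ⟨y, rfl⟩, rho_rho V hr h y⟩

theorem mem_kerPlus_of_rho {c : Endpoint} {s t : ℝ} (h : s ≤ t) (hc : Endpoint.plus t ≤ c)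
    {x : V.obj s} (hx : rho V h x ∈ kerPlus V c t) : x ∈ kerPlus V c s := by
  simp only [kerPlus, Submodule.mem_iInf, LinearMap.mem_ker] at hx ⊢
  intro r hr hcr
  have htr : t ≤ r := (Endpoint.plus_le_minus.1 (hc.trans hcr)).le
  rw [← rho_rho V h htr]
  exact hx r htr hcr

theorem mem_kerMinus_of_rho {c : Endpoint} {s t : ℝ} (h : s ≤ t) (hc : Endpoint.plus t ≤ c)
    {x : V.obj s} (hx : rho V h x ∈ kerMinus V c t) : x ∈ kerMinus V c s := by
  obtain ⟨r, hr, hcr, hx⟩ := (mem_kerMinus hc).1 hx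
  rw [rho_rho] at hx
  exact ker_le_kerMinus (h.trans hr) hcr hx

theorem plusSub_carrier {I : Interval} {t : ℝ} (h : t ∈ I) :
    (plusSub V I).carrier t = imPlus V I.left t ⊓ kerPlus V I.right t := if_pos h

theorem minusSub_carrier {I : Interval} {t : ℝ} (h : t ∈ I) :
    (minusSub V I).carrier t = (imMinus V I.left t ⊓ kerPlus V I.right t) ⊔
      (imPlus V I.left t ⊓ kerMinus V I.right t) := if_pos h

theorem plusSub_carrier_of_not_mem {I : Interval} {t : ℝ} (h : t ∉ I) :
    (plusSub V I).carrier t = ⊥ := if_neg h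

theorem minusSub_carrier_of_not_mem {I : Interval} {t : ℝ} (h : t ∉ I) :
    (minusSub V I).carrier t = ⊥ := if_neg h

/-! ### Decomposition into interval modules -/

theorem exists_rho_eq_of_mem_plusSub (hV : PointwiseFinite V) {I : Interval} {s t : ℝ} (h : s ≤ t)
    (hs : s ∈ I) (ht : t ∈ I) {y : V.obj t} (hy : y ∈ (plusSub V I).carrier t) :
    ∃ x ∈ (plusSub V I).carrier s, rho V h x = y := by
  rw [plusSub_carrier ht] at hy
  rw [plusSub_carrier hs]
  obtain ⟨x, hx, rfl⟩ := imPlus_le_map hV h hs.1 hy.1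
  exact ⟨x, ⟨hx, mem_kerPlus_of_rho h ht.2 hy.2⟩, rfl⟩

/-- The part of ρ(x) in Im⁻ lifts to an element y' of Im⁻ at s. What remains of x is sent into Ker⁻,
so it already lies in Ker⁻. With the preceding lemma, ρ induces isomorphisms of V⁺_I / V⁻_I between
any two points of I. -/
theorem mem_minusSub_of_rho {I : Interval} {s t : ℝ} (h : s ≤ t)
    (hs : s ∈ I) (ht : t ∈ I) {x : V.obj s} (hx : x ∈ (plusSub V I).carrier s)
    (hxt : rho V h x ∈ (minusSub V I).carrier t) : x ∈ (minusSub V I).carrier s := by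
  rw [plusSub_carrier hs] at hx
  rw [minusSub_carrier ht] at hxt
  rw [minusSub_carrier hs]
  obtain ⟨y, hy, z, hz, hyz⟩ := Submodule.mem_sup.1 hxt
  obtain ⟨y', hy', rfl⟩ := imMinus_le_map h hs.1 hy.1
  have hy'' := mem_kerPlus_of_rho h ht.2 hy.2
  have hz' : rho V h (x - y') = z := by rw [map_sub, ← hyz]; abel
  rw [← add_sub_cancel y' x]
  refine Submodule.add_mem_sup ⟨hy', hy''⟩ ⟨sub_mem hx.1 (imMinus_le_imPlus V _ _ hy'), ?_⟩
  exact mem_kerMinus_of_rho h ht.2 (hz' ▸ hz.2)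

/-- Each element of `V⁺_{It}` extends to a morphism `k_I → V⁺_I`. -/
theorem exists_section (hV : PointwiseFinite V) {I : Interval} {t₀ : ℝ} (h₀ : t₀ ∈ I)
    {v : V.obj t₀} (hv : v ∈ (plusSub V I).carrier t₀) :
    ∃ w : ∀ t, V.obj t, w t₀ = v ∧ (∀ t, w t ∈ (plusSub V I).carrier t) ∧
      (∀ t, t ∉ I → w t = 0) ∧ ∀ {s t : ℝ} (h : s ≤ t), s ∈ I → rho V h (w s) = w t := by
  classical
  -- The element v is lifted step by step along a sequence descending towards the left end of I. The
  -- section at t is then pushed forward from any term of the sequence below t.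
  obtain ⟨s, hs, rfl, hsc, hcof⟩ := Endpoint.exists_coinitial_seq h₀.1
  have hsI (n : ℕ) : s n ∈ I := ⟨hsc n, (Endpoint.plus_mono (hs (Nat.zero_le n))).trans h₀.2⟩
  have step (n : ℕ) (y : (plusSub V I).carrier (s n)) :
      ∃ x : (plusSub V I).carrier (s (n + 1)), rho V (hs n.le_succ) x.1 = y.1 := by
    obtain ⟨x, hx, hxy⟩ :=
      exists_rho_eq_of_mem_plusSub hV (hs n.le_succ) (hsI (n + 1)) (hsI n) y.2
    exact ⟨⟨x, hx⟩, hxy⟩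
  choose F hF using step
  let x (n : ℕ) : (plusSub V I).carrier (s n) := Nat.rec ⟨v, hv⟩ (fun n y => F n y) n
  have hx (n : ℕ) : rho V (hs n.le_succ) (x (n + 1)).1 = (x n).1 := hF n (x n)
  have hx' {m n : ℕ} (h : m ≤ n) : rho V (hs h) (x n).1 = (x m).1 := by
    induction n, h using Nat.le_induction with
    | base => exact rho_self V _ _
    | succ n hmn ih => rw [← ih, ← hx n, rho_rho]
  have key {m n : ℕ} {t : ℝ} (hm : s m ≤ t) (hn : s n ≤ t) :
      rho V hm (x m).1 = rho V hn (x n).1 := by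
    rcases le_total m n with h | h
    · rw [← hx' h, rho_rho]
    · rw [← hx' h, rho_rho]
  choose! N hN using hcof
  let w (t : ℝ) : V.obj t := if h : t ∈ I then rho V (hN t h.1) (x (N t)).1 else 0
  have hw {t : ℝ} (h : t ∈ I) {n : ℕ} (hn : s n ≤ t) : w t = rho V hn (x n).1 := by
    simp only [w, dif_pos h]
    exact key _ _
  have hw0 {t : ℝ} (h : t ∉ I) : w t = 0 := dif_neg h
  have hmem (t : ℝ) : w t ∈ (plusSub V I).carrier t := by
    by_cases h : t ∈ I
    · rw [hw h (hN t h.1)]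
      exact (plusSub V I).map_mem _ _ (x (N t)).2
    · rw [hw0 h]; exact zero_mem _
  refine ⟨w, ?_, hmem, fun t => hw0, fun {r t} h hr => ?_⟩
  · rw [hw h₀ (n := 0) le_rfl, rho_self]
    rfl
  · by_cases ht : t ∈ I
    · rw [hw hr (hN r hr.1), hw ht ((hN r hr.1).trans h), rho_rho]
    · rw [hw0 ht]
      refine rho_eq_zero_of_kerPlus V I h hr ht ?_
      have := hmem r
      rw [plusSub_carrier hr] at this
      exact this.2

/-- For each interval `I` there are morphisms `k_I → V⁺_I` that form a basis modulo `V⁻_I`. -/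
theorem exists_basis_mod_minusSub (hV : PointwiseFinite V) (I : Interval) :
    ∃ (d : ℕ) (w : Fin d → ∀ t, V.obj t), (∀ j t, w j t ∈ (plusSub V I).carrier t) ∧
      (∀ j t, t ∉ I → w j t = 0) ∧
      (∀ j {s t : ℝ} (h : s ≤ t), s ∈ I → rho V h (w j s) = w j t) ∧
      ∀ t ∈ I, ((plusSub V I).carrier t ≤
        (minusSub V I).carrier t ⊔ Submodule.span k (Set.range fun j => w j t)) ∧
        ∀ c : Fin d → k, ∑ j, c j • w j t ∈ (minusSub V I).carrier t → c = 0 := by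
  obtain ⟨t₀, h₀⟩ := I.nonempty
  have := hV t₀
  let π := ((minusSub V I).carrier t₀).mkQ
  let b := Module.finBasis k (((plusSub V I).carrier t₀).map π)
  have hex (j) : ∃ w : ∀ t, V.obj t, π (w t₀) = (b j).1 ∧ (∀ t, w t ∈ (plusSub V I).carrier t) ∧
      (∀ t, t ∉ I → w t = 0) ∧ ∀ {s t : ℝ} (h : s ≤ t), s ∈ I → rho V h (w s) = w t := by
    obtain ⟨v, hv, hvj⟩ := (b j).2
    obtain ⟨w, h1, h2⟩ := exists_section hV h₀ hv
    exact ⟨w, by rw [h1, hvj], h2⟩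
  choose w hwb hwmem hw0 hwrho using hex
  have hsum (s t : ℝ) (h : s ≤ t) (hs : s ∈ I) (c : Fin _ → k) :
      rho V h (∑ j, c j • w j s) = ∑ j, c j • w j t := by
    rw [map_sum]
    exact Finset.sum_congr rfl fun j _ => by rw [map_smul, hwrho j h hs]
  have hmem (t : ℝ) (c : Fin _ → k) : ∑ j, c j • w j t ∈ (plusSub V I).carrier t :=
    Submodule.sum_mem _ fun j _ => Submodule.smul_mem _ _ (hwmem j t)
  have hspan (t : ℝ) (v : V.obj t) :
      v ∈ (minusSub V I).carrier t ⊔ Submodule.span k (Set.range fun j => w j t) ↔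
        ∃ c : Fin _ → k, v - ∑ j, c j • w j t ∈ (minusSub V I).carrier t := by
    rw [Submodule.mem_sup]
    constructor
    · rintro ⟨y, hy, z, hz, rfl⟩
      obtain ⟨c, rfl⟩ := (Submodule.mem_span_range_iff_exists_fun k).1 hz
      exact ⟨c, by simpa using hy⟩
    · rintro ⟨c, hc⟩
      exact ⟨_, hc, _, (Submodule.mem_span_range_iff_exists_fun k).2 ⟨c, rfl⟩, sub_add_cancel _ _⟩
  have hπ (c : Fin _ → k) : π (∑ j, c j • w j t₀) =
      ((∑ j, c j • b j : ((plusSub V I).carrier t₀).map π) : _) := by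
    simp only [map_sum, map_smul, hwb, Submodule.coe_sum, Submodule.coe_smul]
  have hker (v : V.obj t₀) : π v = 0 ↔ v ∈ (minusSub V I).carrier t₀ :=
    Submodule.Quotient.mk_eq_zero _
  have base1 (v) (hv : v ∈ (plusSub V I).carrier t₀) :
      ∃ c : Fin _ → k, v - ∑ j, c j • w j t₀ ∈ (minusSub V I).carrier t₀ := by
    refine ⟨b.repr ⟨π v, v, hv, rfl⟩, ?_⟩
    rw [← hker, map_sub, sub_eq_zero]
    refine Eq.trans ?_ (hπ _).symm
    rw [b.sum_repr]
  have base2 (c : Fin _ → k) (hc : ∑ j, c j • w j t₀ ∈ (minusSub V I).carrier t₀) : c = 0 := by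
    rw [← hker] at hc
    have h1 := (hπ c).symm.trans hc
    have h2 : ∑ j, c j • b j = 0 := Subtype.ext h1
    exact funext fun j => Fintype.linearIndependent_iff.1 b.linearIndependent c h2 j
  -- Both properties hold at t₀ by the choice of b. They carry over to every t in I because ρ
  -- identifies the quotients V⁺_I / V⁻_I at t₀ and t, in whichever direction the two points
  -- compare.
  refine ⟨_, w, hwmem, hw0, hwrho, fun t ht => ⟨fun v hv => (hspan t v).2 ?_, fun c hc => ?_⟩⟩
  · rcases le_total t₀ t with h | h
    · obtain ⟨x, hx, rfl⟩ := exists_rho_eq_of_mem_plusSub hV h h₀ ht hv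
      obtain ⟨c, hc⟩ := base1 x hx
      refine ⟨c, ?_⟩
      rw [← hsum _ _ h h₀, ← map_sub]
      exact (minusSub V I).map_mem h _ hc
    · obtain ⟨c, hc⟩ := base1 _ ((plusSub V I).map_mem h v hv)
      refine ⟨c, mem_minusSub_of_rho h ht h₀ (sub_mem hv (hmem t c)) ?_⟩
      rw [map_sub, hsum _ _ h ht]
      exact hc
  · rcases le_total t₀ t with h | h
    · rw [← hsum _ _ h h₀] at hc
      exact base2 c (mem_minusSub_of_rho h h₀ ht (hmem t₀ c) hc)
    · have := (minusSub V I).map_mem h _ hc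
      rw [hsum _ _ h ht] at this
      exact base2 c this

/-- A pointwise finite-dimensional persistence module is a direct sum of interval modules
(Crawley-Boevey's theorem). -/
theorem exists_isFrame (hV : PointwiseFinite V) :
    ∃ (ι : Type) (K : ι → Interval) (w : ι → ∀ t, V.obj t), IsFrame V K w := by
  classical
  choose d w hmem h0 hrho hbasis using exists_basis_mod_minusSub hV
  refine ⟨Σ I, Fin (d I), Sigma.fst, fun i => w i.1 i.2, fun i t h => h0 i.1 i.2 t h,
    fun i s t h hs => hrho i.1 i.2 h hs, fun t => ?_, fun t => ?_⟩
  · rw [linearIndepOn_iff]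
    intro l hl hl0
    by_contra hne
    -- Take the interval occurring in the relation that is largest for the lexicographic order of
    -- (left, right). A term of any other interval either starts earlier, hence lies in Im⁻, or
    -- starts together with I and ends earlier, hence lies in Im⁺ ∩ Ker⁻.
    obtain ⟨⟨I, j₀⟩, hi₀, hmax⟩ := Finset.exists_max_image l.support
      (fun i => toLex (i.1.left, i.1.right)) (Finsupp.support_nonempty_iff.2 hne)
    have ht : t ∈ I := hl hi₀
    have hrest : ∀ i ∈ l.support, i.1 ≠ I → l i • w i.1 i.2 t ∈
        imMinus V I.left t ⊔ (imPlus V I.left t ⊓ kerMinus V I.right t) := by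
      intro i hi hiI
      refine Submodule.smul_mem _ _ ?_
      have hti : t ∈ i.1 := hl hi
      have hw := hmem i.1 i.2 t
      rw [plusSub_carrier hti] at hw
      have hle := hmax i hi
      rw [Prod.Lex.le_iff] at hle
      rcases hle with hlt | ⟨heq, hle⟩
      · exact (le_sup_left : _ ≤ imMinus V I.left t ⊔ _) (imPlus_le_imMinus hlt ht.1 hw.1)
      · have heq : i.1.left = I.left := heq
        have hlt : i.1.right < I.right :=
          lt_of_le_of_ne hle fun h => hiI (Interval.ext heq h)
        exact (le_sup_right : _ ≤ imMinus V I.left t ⊔ _)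
          ⟨heq ▸ hw.1, kerPlus_le_kerMinus hlt hti.2 hw.2⟩
    have hsplit : ∑ j, l ⟨I, j⟩ • w I j t =
        ∑ i ∈ l.support.filter (fun i => i.1 = I), l i • w i.1 i.2 t := by
      rw [← Finset.sum_subset (Finset.subset_univ
        (Finset.univ.filter fun j => l (⟨I, j⟩ : Σ I, Fin (d I)) ≠ 0))]
      · refine Finset.sum_of_injOn (fun j => (⟨I, j⟩ : Σ I, Fin (d I)))
          (fun i _ j _ h => by simpa using h) (fun j hj => by simpa using hj) ?_ (fun _ _ => rfl)
        rintro ⟨I', j⟩ hi hj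
        obtain ⟨h1, h2⟩ := Finset.mem_filter.1 hi
        obtain rfl : I' = I := h2
        exact absurd ⟨j, by simpa using h1, rfl⟩ hj
      · intro j _ hj
        have : l ⟨I, j⟩ = 0 := by simpa using hj
        rw [this, zero_smul]
    rw [Finsupp.linearCombination_apply, Finsupp.sum,
      ← Finset.sum_filter_add_sum_filter_not l.support (fun i : Σ I, Fin (d I) => i.1 = I)
        (fun i => l i • w i.1 i.2 t), ← hsplit] at hl0
    have h1 : ∑ j, l ⟨I, j⟩ • w I j t ∈
        imMinus V I.left t ⊔ (imPlus V I.left t ⊓ kerMinus V I.right t) := by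
      rw [eq_neg_of_add_eq_zero_left hl0]
      exact neg_mem (Submodule.sum_mem _ fun i hi =>
        hrest i (Finset.mem_filter.1 hi).1 (Finset.mem_filter.1 hi).2)
    have h2 : ∑ j, l ⟨I, j⟩ • w I j t ∈ (plusSub V I).carrier t :=
      Submodule.sum_mem _ fun j _ => Submodule.smul_mem _ _ (hmem I j t)
    -- The summand y in Im⁻ is the difference of the sum, which lies in Ker⁺, and z, which lies in
    -- Ker⁻ ≤ Ker⁺. So y is in Im⁻ ∩ Ker⁺, as membership in V⁻_I requires.
    have h3 : ∑ j, l ⟨I, j⟩ • w I j t ∈ (minusSub V I).carrier t := by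
      rw [plusSub_carrier ht] at h2
      rw [minusSub_carrier ht]
      obtain ⟨y, hy, z, hz, hyz⟩ := Submodule.mem_sup.1 h1
      rw [← hyz] at h2 ⊢
      refine Submodule.add_mem_sup ⟨hy, ?_⟩ hz
      have := sub_mem h2.2 (kerMinus_le_kerPlus V _ _ hz.2)
      simpa using this
    have h4 := congrFun ((hbasis I t ht).2 (fun j => l ⟨I, j⟩) h3) j₀
    exact (Finsupp.mem_support_iff.1 hi₀) h4
  · set S := Submodule.span k (Set.range fun i : Σ I, Fin (d I) => w i.1 i.2 t) with hS
    have := hV t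
    by_contra hne
    -- If S were proper, let a be the cut above which the images Im ρ_{st} stop being contained in
    -- S. Then Im⁻_a ≤ S, while Im⁺_a, being one of these images, is not contained in S.
    obtain ⟨a, ha⟩ := Endpoint.exists_cut (S := {s | ∀ h : s ≤ t, ¬ LinearMap.range (rho V h) ≤ S})
      (fun s s' hss hs h h' => hs (hss.trans h) ((range_rho_mono V hss h).trans h'))
    have hat : a ≤ Endpoint.minus t := by
      refine (ha t).1 fun h h' => hne (eq_top_iff.2 ?_)
      refine le_trans (fun x _ => LinearMap.mem_range.2 ⟨x, rho_self V le_rfl x⟩) h'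
    have haS : ¬ imPlus V a t ≤ S := by
      obtain ⟨s, hs, has, heq⟩ := exists_imPlus_eq hV hat
      rw [heq]
      exact (ha s).2 has hs
    have haS' : imMinus V a t ≤ S :=
      iSup_le fun s => iSup_le fun hs => iSup_le fun hc => by
        by_contra h
        exact Endpoint.not_le_minus.2 hc ((ha s).1 fun _ => h)
    -- The same choice for kernels inside Im⁺_a: b is the cut above which Im⁺_a ∩ Ker ρ_{tr} is no
    -- longer contained in S.
    obtain ⟨b, hb⟩ := Endpoint.exists_cut
      (S := {r | ∃ h : t ≤ r, ¬ imPlus V a t ⊓ LinearMap.ker (rho V h) ≤ S})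
      (fun r r' hrr ⟨h, h'⟩ => ⟨h.trans hrr, fun h'' =>
        h' ((inf_le_inf_left _ (ker_rho_mono V h hrr)).trans h'')⟩)
    have htb : Endpoint.plus t ≤ b := by
      rw [← Endpoint.not_le_minus]
      intro h
      obtain ⟨_, h'⟩ := (hb t).2 h
      refine h' fun x hx => ?_
      have : rho V le_rfl x = 0 := hx.2
      rw [rho_self] at this
      rw [this]
      exact zero_mem _
    have hbS : ¬ imPlus V a t ⊓ kerPlus V b t ≤ S := by
      let X := {r : ℝ // b ≤ Endpoint.minus r}
      have hX (r : X) : t ≤ r.1 := (Endpoint.plus_le_minus.1 (htb.trans r.2)).le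
      rcases isEmpty_or_nonempty X with hX' | hX'
      -- With no real above b the intersection is empty, so Ker⁺ is the whole space and the claim is
      -- the one already known for Im⁺_a.
      · have : kerPlus V b t = ⊤ := eq_top_iff.2
          (le_iInf fun r => le_iInf fun _ => le_iInf fun hr => (hX'.false ⟨r, hr⟩).elim)
        rwa [this, inf_top_eq]
      · obtain ⟨r, hr⟩ := exists_forall_le_of_monotone
          (Φ := fun r : X => LinearMap.ker (rho V (hX r))) (fun r r' h => ker_rho_mono V (hX r) h)
        have : kerPlus V b t = LinearMap.ker (rho V (hX r)) :=
          le_antisymm (kerPlus_le_ker _ r.2)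
            (le_iInf fun r' => le_iInf fun _ => le_iInf fun hr' => hr ⟨r', hr'⟩)
        rw [this]
        obtain ⟨_, h⟩ := (hb r).2 r.2
        exact h
    have hbS' : imPlus V a t ⊓ kerMinus V b t ≤ S := by
      rintro x ⟨hx1, hx2⟩
      obtain ⟨r, hr, hrb, hx⟩ := (mem_kerMinus htb).1 hx2
      by_contra h
      exact Endpoint.not_le_minus.2 hrb ((hb r).1 ⟨hr, fun h' => h (h' ⟨hx1, hx⟩)⟩)
    -- For this I, V⁻_I ≤ S and the sections of I lie in S, hence V⁺_I ≤ S, contradicting the choice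
    -- of a and b.
    let I : Interval := ⟨a, b, hat.trans_lt ((Endpoint.minus_lt_plus t).trans_le htb)⟩
    have ht : t ∈ I := ⟨hat, htb⟩
    have h1 := (hbasis I t ht).1
    rw [plusSub_carrier ht, minusSub_carrier ht] at h1
    refine hbS (h1.trans (sup_le (sup_le (inf_le_left.trans haS') hbS') ?_))
    refine Submodule.span_mono ?_
    rintro _ ⟨j, rfl⟩
    exact ⟨⟨I, j⟩, rfl⟩

end

/-! ### Coordinate subspaces -/

section

variable {V : PersMod.{u, v} k} {ι : Type w} {K : ι → Interval} {w : ι → ∀ t : ℝ, V.obj t}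

/-- The subspace of `V(t)` spanned by the vectors `w i t` with `S i`. -/
def coordSub (w : ι → ∀ t : ℝ, V.obj t) (t : ℝ) (S : ι → Prop) : Submodule k (V.obj t) :=
  Submodule.span k ((fun i => w i t) '' {i | S i})

theorem mem_coordSub_of (w : ι → ∀ t : ℝ, V.obj t) (t : ℝ) {S : ι → Prop} {i : ι} (h : S i) :
    w i t ∈ coordSub w t S := Submodule.subset_span ⟨i, h, rfl⟩

theorem coordSub_le_iff {t : ℝ} {S : ι → Prop} {P : Submodule k (V.obj t)} :
    coordSub w t S ≤ P ↔ ∀ i, S i → w i t ∈ P := by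
  rw [coordSub, Submodule.span_le]
  exact Set.image_subset_iff

theorem coordSub_sup (t : ℝ) (S T : ι → Prop) :
    coordSub w t S ⊔ coordSub w t T = coordSub w t (fun i => S i ∨ T i) := by
  rw [coordSub, coordSub, ← Submodule.span_union, ← Set.image_union]
  rfl

namespace IsFrame

variable (hw : IsFrame V K w)
include hw

/-- The basis of `V(t)`. -/
noncomputable def basis (t : ℝ) : Module.Basis {i // t ∈ K i} k (V.obj t) :=
  Module.Basis.mk (hw.linearIndepOn t) (by
    rw [← hw.span_eq t, Submodule.span_le]
    rintro _ ⟨i, rfl⟩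
    by_cases hi : t ∈ K i
    · exact Submodule.subset_span ⟨⟨i, hi⟩, rfl⟩
    · simp only [hw.eq_zero i t hi]
      exact zero_mem _)

theorem basis_apply (t : ℝ) (i : {i // t ∈ K i}) : hw.basis t i = w i t :=
  Module.Basis.mk_apply _ _ i

theorem coordSub_mono {t : ℝ} {S T : ι → Prop} (h : ∀ i, t ∈ K i → S i → T i) :
    coordSub w t S ≤ coordSub w t T := by
  rw [coordSub_le_iff]
  intro i hi
  by_cases ht : t ∈ K i
  · exact mem_coordSub_of w t (h i ht hi)
  · rw [hw.eq_zero i t ht]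
    exact zero_mem _

theorem coordSub_congr {t : ℝ} {S T : ι → Prop} (h : ∀ i, t ∈ K i → (S i ↔ T i)) :
    coordSub w t S = coordSub w t T :=
  le_antisymm (hw.coordSub_mono fun i hi => (h i hi).1) (hw.coordSub_mono fun i hi => (h i hi).2)

/-- Indices of bars that miss t give zero vectors, so only the coordinates at bars containing t
count. All lattice operations on coordinate subspaces thereby become operations on predicates. -/
theorem mem_coordSub {t : ℝ} {S : ι → Prop} {v : V.obj t} :
    v ∈ coordSub w t S ↔ ∀ i : {i // t ∈ K i}, (hw.basis t).repr v i ≠ 0 → S i := by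
  have h : coordSub w t S = Submodule.span k (hw.basis t '' {i | S i}) := by
    refine le_antisymm (coordSub_le_iff.2 fun i hi => ?_) (Submodule.span_le.2 ?_)
    · by_cases ht : t ∈ K i
      · exact Submodule.subset_span ⟨⟨i, ht⟩, hi, hw.basis_apply t _⟩
      · rw [hw.eq_zero i t ht]
        exact zero_mem _
    · rintro _ ⟨i, hi, rfl⟩
      rw [hw.basis_apply]
      exact mem_coordSub_of w t hi
  rw [h, Module.Basis.mem_span_image]
  refine ⟨fun h i hi => h (Finsupp.mem_support_iff.2 hi), fun h i hi => ?_⟩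
  exact h i (Finsupp.mem_support_iff.1 hi)

theorem coordSub_inf (t : ℝ) (S T : ι → Prop) :
    coordSub w t S ⊓ coordSub w t T = coordSub w t (fun i => S i ∧ T i) := by
  ext v
  simp only [Submodule.mem_inf, hw.mem_coordSub]
  exact ⟨fun h i hi => ⟨h.1 i hi, h.2 i hi⟩,
    fun h => ⟨fun i hi => (h i hi).1, fun i hi => (h i hi).2⟩⟩

theorem range_rho {s t : ℝ} (h : s ≤ t) :
    LinearMap.range (rho V h) = coordSub w t (fun i => (K i).left ≤ Endpoint.minus s) := by
  rw [LinearMap.range_eq_map, ← hw.span_eq s, Submodule.map_span]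
  refine le_antisymm (Submodule.span_le.2 ?_) (coordSub_le_iff.2 fun i hi => ?_)
  · rintro _ ⟨_, ⟨i, rfl⟩, rfl⟩
    by_cases hs : s ∈ K i
    · simp only [hw.rho_eq i h hs]
      exact mem_coordSub_of w t hs.1
    · simp only [hw.eq_zero i s hs, map_zero]
      exact zero_mem _
  · by_cases ht : t ∈ K i
    · exact Submodule.subset_span ⟨_, ⟨i, rfl⟩, hw.rho_eq i h ((Interval.mem_iff_of_le h ht).2 hi)⟩
    · rw [hw.eq_zero i t ht]
      exact zero_mem _

theorem repr_rho {s t : ℝ} (h : s ≤ t) (v : V.obj s) (i : ι) (hs : s ∈ K i) (ht : t ∈ K i) :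
    (hw.basis t).repr (rho V h v) ⟨i, ht⟩ = (hw.basis s).repr v ⟨i, hs⟩ := by
  have : (Finsupp.lapply ⟨i, ht⟩) ∘ₗ (hw.basis t).repr.toLinearMap ∘ₗ rho V h =
      (Finsupp.lapply ⟨i, hs⟩) ∘ₗ (hw.basis s).repr.toLinearMap := by
    refine (hw.basis s).ext fun j => ?_
    simp only [LinearMap.comp_apply, LinearEquiv.coe_coe, Module.Basis.repr_self, Finsupp.lapply_apply]
    rw [hw.basis_apply, hw.rho_eq _ h j.2]
    by_cases hj : t ∈ K j
    · rw [← hw.basis_apply t ⟨j, hj⟩, Module.Basis.repr_self]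
      by_cases hji : j.1 = i
      · subst hji
        rw [Finsupp.single_eq_same, Finsupp.single_eq_same]
      · rw [Finsupp.single_eq_of_ne fun h => hji (congrArg Subtype.val h).symm,
          Finsupp.single_eq_of_ne fun h => hji (congrArg Subtype.val h).symm]
    · rw [hw.eq_zero _ _ hj, map_zero, Finsupp.single_eq_of_ne]
      · rfl
      · rintro rfl
        exact hj ht
  exact LinearMap.congr_fun this v

theorem ker_rho {s t : ℝ} (h : s ≤ t) :
    LinearMap.ker (rho V h) = coordSub w s (fun i => (K i).right ≤ Endpoint.minus t) := by
  refine le_antisymm (fun v hv => hw.mem_coordSub.2 fun i hi => ?_)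
    (coordSub_le_iff.2 fun i hi => ?_)
  · rw [← Interval.not_mem_iff h i.2]
    intro ht
    rw [← hw.repr_rho h v i i.2 ht, LinearMap.mem_ker.1 hv, map_zero] at hi
    exact hi rfl
  · rw [LinearMap.mem_ker]
    by_cases hs : s ∈ K i
    · rw [hw.rho_eq i h hs, hw.eq_zero i t ((Interval.not_mem_iff h hs).2 hi)]
    · rw [hw.eq_zero i s hs, map_zero]

theorem imPlus_eq (c : Endpoint) (t : ℝ) :
    imPlus V c t = coordSub w t (fun i => (K i).left ≤ c) := by
  refine le_antisymm (fun v hv => hw.mem_coordSub.2 fun i hi => ?_) ?_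
  · rw [Endpoint.le_iff_forall_le_minus]
    intro s hs
    rcases le_total s t with h | h
    · have := imPlus_le_range h hs hv
      rw [hw.range_rho] at this
      exact hw.mem_coordSub.1 this i hi
    -- The reals s ≥ t impose no condition through images; here the inequality holds because the bar
    -- contains t.
    · exact i.2.1.trans (Endpoint.minus_mono h)
  · refine le_iInf fun s => le_iInf fun h => le_iInf fun hs => ?_
    rw [hw.range_rho]
    exact hw.coordSub_mono fun i _ hi => hi.trans hs

theorem imMinus_eq {c : Endpoint} {t : ℝ} (hc : c ≤ Endpoint.minus t) :
    imMinus V c t = coordSub w t (fun i => (K i).left < c) := by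
  refine le_antisymm ?_ (coordSub_le_iff.2 fun i hi => ?_)
  · refine iSup_le fun s => iSup_le fun h => iSup_le fun hs => ?_
    rw [hw.range_rho]
    exact hw.coordSub_mono fun i _ hi => hi.trans_lt ((Endpoint.minus_lt_plus s).trans_le hs)
  · obtain ⟨s, h1, h2⟩ := Endpoint.exists_between hi
    have hs : s ≤ t := (Endpoint.plus_le_minus.1 (h2.trans hc)).le
    refine range_le_imMinus hs h2 ?_
    rw [hw.range_rho]
    exact mem_coordSub_of w t h1

theorem kerPlus_eq {c : Endpoint} {t : ℝ} (hc : Endpoint.plus t ≤ c) :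
    kerPlus V c t = coordSub w t (fun i => (K i).right ≤ c) := by
  refine le_antisymm (fun v hv => hw.mem_coordSub.2 fun i hi => ?_) ?_
  · rw [Endpoint.le_iff_forall_le_minus]
    intro r hr
    have h : t ≤ r := (Endpoint.plus_le_minus.1 (hc.trans hr)).le
    have := kerPlus_le_ker h hr hv
    rw [hw.ker_rho] at this
    exact hw.mem_coordSub.1 this i hi
  · refine le_iInf fun s => le_iInf fun h => le_iInf fun hs => ?_
    rw [hw.ker_rho]
    exact hw.coordSub_mono fun i _ hi => hi.trans hs

theorem kerMinus_eq (c : Endpoint) (t : ℝ) :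
    kerMinus V c t = coordSub w t (fun i => (K i).right < c) := by
  refine le_antisymm ?_ (coordSub_le_iff.2 fun i hi => ?_)
  · refine iSup_le fun s => iSup_le fun h => iSup_le fun hs => ?_
    rw [hw.ker_rho]
    exact hw.coordSub_mono fun i _ hi => hi.trans_lt ((Endpoint.minus_lt_plus s).trans_le hs)
  · by_cases ht : t ∈ K i
    · obtain ⟨r, h1, h2⟩ := Endpoint.exists_between hi
      have hr : t ≤ r := (Endpoint.plus_le_minus.1 (ht.2.trans h1)).le
      refine ker_le_kerMinus hr h2 ?_
      rw [hw.ker_rho]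
      exact mem_coordSub_of w t h1
    · rw [hw.eq_zero i t ht]
      exact zero_mem _

theorem plusSub_eq {I : Interval} {t : ℝ} (ht : t ∈ I) : (plusSub V I).carrier t =
    coordSub w t (fun i => (K i).left ≤ I.left ∧ (K i).right ≤ I.right) := by
  rw [plusSub_carrier ht, hw.imPlus_eq, hw.kerPlus_eq ht.2, hw.coordSub_inf]

/-- Being strictly smaller in one endpoint and at most equal in the other means being at most I
without being I. So V⁺_I and V⁻_I differ exactly by the bars equal to I. -/
theorem minusSub_eq {I : Interval} {t : ℝ} (ht : t ∈ I) : (minusSub V I).carrier t =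
    coordSub w t (fun i => ((K i).left ≤ I.left ∧ (K i).right ≤ I.right) ∧ K i ≠ I) := by
  rw [minusSub_carrier ht, hw.imPlus_eq, hw.imMinus_eq ht.1, hw.kerPlus_eq ht.2,
    hw.kerMinus_eq, hw.coordSub_inf, hw.coordSub_inf, coordSub_sup]
  refine hw.coordSub_congr fun i _ => ?_
  rw [Ne, Interval.ext_iff, not_and_or]
  constructor
  · rintro (⟨h1, h2⟩ | ⟨h1, h2⟩)
    · exact ⟨⟨h1.le, h2⟩, Or.inl h1.ne⟩
    · exact ⟨⟨h1, h2.le⟩, Or.inr h2.ne⟩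
  · rintro ⟨⟨h1, h2⟩, h3 | h3⟩
    · exact Or.inl ⟨lt_of_le_of_ne h1 h3, h2⟩
    · exact Or.inr ⟨h1, lt_of_le_of_ne h2 h3⟩

/-! ### Dimensions and multiplicities -/

theorem finite (hV : PointwiseFinite V) (t : ℝ) : {i | t ∈ K i}.Finite := by
  have := hV t
  exact (hw.linearIndepOn t).finite_of_isNoetherian

theorem finrank_coordSub (t : ℝ) (S : ι → Prop) :
    Module.finrank k (coordSub w t S) = {i | S i ∧ t ∈ K i}.ncard := by
  have h1 : coordSub w t S = coordSub w t (fun i => S i ∧ t ∈ K i) :=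
    hw.coordSub_congr fun i hi => by simp [hi]
  have h2 : LinearIndependent k (fun i : {i | S i ∧ t ∈ K i} => w i t) :=
    (hw.linearIndepOn t).mono fun i hi => hi.2
  rw [h1, coordSub, Set.image_eq_range,
    Module.finrank_eq_nat_card_basis (Module.Basis.span h2)]
  rfl

theorem finrank_coordSub_add (hV : PointwiseFinite V) {t : ℝ} {S T D : ι → Prop}
    (h : ∀ i, S i ∧ t ∈ K i ↔ (T i ∧ t ∈ K i) ∨ D i) (hTD : ∀ i, T i → ¬ D i) :
    Module.finrank k (coordSub w t S) =
      Module.finrank k (coordSub w t T) + {i | D i}.ncard := by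
  rw [hw.finrank_coordSub, hw.finrank_coordSub,
    ← Set.ncard_union_eq (s := {i | T i ∧ t ∈ K i}) (t := {i | D i})
      (Set.disjoint_left.2 fun i hi => hTD i hi.1)
      ((hw.finite hV t).subset fun i hi => hi.2)
      ((hw.finite hV t).subset fun i hi => ((h i).2 (Or.inr hi)).2)]
  exact congrArg Set.ncard (Set.ext h)

theorem finrank_plusSub (hV : PointwiseFinite V) {I : Interval} {t : ℝ} (ht : t ∈ I) :
    Module.finrank k ((plusSub V I).carrier t) =
      Module.finrank k ((minusSub V I).carrier t) + {i | K i = I}.ncard := by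
  rw [hw.plusSub_eq ht, hw.minusSub_eq ht]
  refine hw.finrank_coordSub_add hV (fun i => ?_) fun i hi => hi.2
  by_cases h : K i = I
  · simp [h, ht]
  · simp [h]

/-- All these bars contain a common real t, where the dimension is finite. -/
theorem finite_of_left_right (hV : PointwiseFinite V) {a b : Endpoint} (h : a < b) :
    {i | (K i).left ≤ a ∧ b ≤ (K i).right}.Finite := by
  obtain ⟨t, h1, h2⟩ := Endpoint.exists_between h
  exact (hw.finite hV t).subset fun i hi => ⟨hi.1.trans h1, h2.trans hi.2⟩

theorem finite_eq (hV : PointwiseFinite V) (I : Interval) : {i | K i = I}.Finite :=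
  (hw.finite_of_left_right hV I.left_lt_right).subset fun i hi => by
    have hi : K i = I := hi
    exact ⟨(congrArg Interval.left hi).le, (congrArg Interval.right hi).ge⟩

/-- The multiplicity of I is the codimension of V⁻_I in V⁺_I at a point of I, which does not depend
on the frame. -/
theorem encard_eq_encard (hV : PointwiseFinite V) {ι' : Type*} {K' : ι' → Interval}
    {w' : ι' → ∀ t : ℝ, V.obj t} (hw' : IsFrame V K' w') (I : Interval) :
    {i | K i = I}.encard = {i | K' i = I}.encard := by
  obtain ⟨t, ht⟩ := I.nonempty
  have h1 := hw.finrank_plusSub hV ht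
  have h2 := hw'.finrank_plusSub hV ht
  rw [← (hw.finite_eq hV I).cast_ncard_eq, ← (hw'.finite_eq hV I).cast_ncard_eq]
  have : {i | K i = I}.ncard = {i | K' i = I}.ncard := by omega
  rw [this]

end IsFrame

/-! ### Barcodes and labelled bases -/

theorem PersistenceBasis.nonempty (hV : PointwiseFinite V) : Nonempty (PersistenceBasis V) := by
  obtain ⟨ι, K, w, hw⟩ := exists_isFrame hV
  exact ⟨hw.toBasis⟩

theorem IsFrame.barcode_eq (hV : PointwiseFinite V) (hw : IsFrame V K w) (I : Interval) :
    barcode V I = {i | K i = I}.encard := by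
  have h := PersistenceBasis.nonempty hV
  rw [barcode, dif_pos h]
  exact h.some.isFrame.encard_eq_encard hV hw I

theorem IsFrame.exists_equiv_rep (hV : PointwiseFinite V) (hw : IsFrame V K w) :
    ∃ e : ι ≃ Rep (barcode V), ∀ i, (e i).1.1 = K i := by
  have h (I : Interval) : Nonempty ({i // K i = I} ≃
      {n : ℕ // 1 ≤ n ∧ (n : ℕ∞) ≤ barcode V I}) := by
    have hfin := hw.finite_eq hV I
    have h1 : {n : ℕ | 1 ≤ n ∧ (n : ℕ∞) ≤ barcode V I} =
        (Finset.Icc 1 {i | K i = I}.ncard : Finset ℕ) := by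
      ext n
      rw [hw.barcode_eq hV, ← hfin.cast_ncard_eq]
      simp
    have : Finite {i // K i = I} := hfin
    have : Finite {n : ℕ // 1 ≤ n ∧ (n : ℕ∞) ≤ barcode V I} := by
      have : {n : ℕ | 1 ≤ n ∧ (n : ℕ∞) ≤ barcode V I}.Finite := by
        rw [h1]
        exact Finset.finite_toSet _
      exact this
    refine Finite.card_eq.1 ?_
    have h2 : Nat.card {i // K i = I} = {i | K i = I}.ncard := rfl
    have h3 : Nat.card {n : ℕ // 1 ≤ n ∧ (n : ℕ∞) ≤ barcode V I} =
      {n : ℕ | 1 ≤ n ∧ (n : ℕ∞) ≤ barcode V I}.ncard := rfl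
    rw [h2, h3, h1, Set.ncard_coe_finset, Nat.card_Icc]
    omega
  let e2 : (Σ I, {n : ℕ // 1 ≤ n ∧ (n : ℕ∞) ≤ barcode V I}) ≃ Rep (barcode V) :=
    { toFun := fun x => ⟨(x.1, x.2.1), x.2.2⟩
      invFun := fun y => ⟨y.1.1, y.1.2, y.2⟩
      left_inv := fun _ => rfl
      right_inv := fun _ => rfl }
  exact ⟨((Equiv.sigmaFiberEquiv K).symm.trans (Equiv.sigmaCongrRight fun I => (h I).some)).trans e2,
    fun i => rfl⟩

end

theorem encard_setOf_rep {ι : Type*} {K : ι → Interval} {m : Barcode} (e : ι ≃ Rep m)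
    (he : ∀ i, (e i).1.1 = K i) (P : Interval → Prop) :
    {x : Rep m | P x.1.1}.encard = {i | P (K i)}.encard := by
  refine Set.encard_congr (Equiv.subtypeEquiv e.symm fun x => ?_)
  change P x.1.1 ↔ P (K (e.symm x))
  rw [← he, e.apply_symm_apply]

/-! ### Comparison of multiplicities -/

section

variable {E F : Type*} [AddCommGroup E] [Module k E] [FiniteDimensional k E]
  [AddCommGroup F] [Module k F] [FiniteDimensional k F]

theorem finrank_map_add_finrank_inf_ker {F : Type*} [AddCommGroup F] [Module k F]
    (φ : E →ₗ[k] F) (A : Submodule k E) :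
    Module.finrank k (A.map φ) + Module.finrank k (A ⊓ LinearMap.ker φ : Submodule k E) =
      Module.finrank k A := by
  have h := LinearMap.finrank_range_add_finrank_ker (φ.domRestrict A)
  rw [LinearMap.range_domRestrict, LinearMap.ker_domRestrict, ← Submodule.finrank_map_subtype_eq,
    Submodule.map_comap_subtype] at h
  exact h

theorem finrank_map_mkQ_comp {F : Type*} [AddCommGroup F] [Module k F]
    (φ : E →ₗ[k] F) (A : Submodule k E) (B : Submodule k F) :
    Module.finrank k (A.map (B.mkQ ∘ₗ φ)) +
      Module.finrank k (A ⊓ B.comap φ : Submodule k E) = Module.finrank k A := by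
  rw [← finrank_map_add_finrank_inf_ker (B.mkQ ∘ₗ φ) A, LinearMap.ker_comp, Submodule.ker_mkQ]

theorem finrank_map_mkQ {A B : Submodule k F} (h : B ≤ A) :
    Module.finrank k (A.map B.mkQ) + Module.finrank k B = Module.finrank k A := by
  rw [← finrank_map_add_finrank_inf_ker B.mkQ A, Submodule.ker_mkQ, inf_eq_right.2 h]

/-- The map φ embeds A / (A ∩ φ⁻¹B') into A' / B', and the denominator on the left has dimension at
most dim B. Sums replace differences of dimensions to avoid truncated subtraction. -/
theorem finrank_add_le_of_inf_comap_le (φ : E →ₗ[k] F) {A B : Submodule k E}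
    {A' B' : Submodule k F} (hA : A.map φ ≤ A') (hB : B' ≤ A') (h : A ⊓ B'.comap φ ≤ B) :
    Module.finrank k A + Module.finrank k B' ≤ Module.finrank k A' + Module.finrank k B := by
  have h1 := finrank_map_mkQ_comp φ A B'
  have h2 := finrank_map_mkQ hB
  have h3 := Submodule.finrank_mono h
  have h4 : A.map (B'.mkQ ∘ₗ φ) ≤ A'.map B'.mkQ := by
    rw [Submodule.map_comp]
    exact Submodule.map_mono hA
  have h5 := Submodule.finrank_mono h4
  omega

/-- Dually, the image of A in the quotient by B' covers A' / B', and B is contained in the kernel of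
this map on A. -/
theorem finrank_add_le_of_le_map (φ : E →ₗ[k] F) {A B : Submodule k E}
    {A' B' : Submodule k F} (hA : A' ≤ A.map φ) (hB : B.map φ ≤ B') (h : B ≤ A) (h' : B' ≤ A') :
    Module.finrank k A' + Module.finrank k B ≤ Module.finrank k A + Module.finrank k B' := by
  have h1 := finrank_map_mkQ_comp φ A B'
  have h2 := finrank_map_mkQ h'
  have h3 : B ≤ A ⊓ B'.comap φ := le_inf h (Submodule.map_le_iff_le_comap.1 hB)
  have h4 : A'.map B'.mkQ ≤ A.map (B'.mkQ ∘ₗ φ) := by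
    rw [Submodule.map_comp]
    exact Submodule.map_mono hA
  have h5 := Submodule.finrank_mono h4
  have h6 := Submodule.finrank_mono h3
  omega

end

section

variable {V U : PersMod.{u, v} k} (f : V ⟶ U)

theorem map_range_rho_le {s t : ℝ} (h : s ≤ t) :
    (LinearMap.range (rho V h)).map (f.app t).hom ≤ LinearMap.range (rho U h) := by
  rintro _ ⟨_, ⟨x, rfl⟩, rfl⟩
  exact ⟨(f.app s).hom x, (app_rho f h x).symm⟩

theorem map_ker_rho_le {s t : ℝ} (h : s ≤ t) :
    (LinearMap.ker (rho V h)).map (f.app s).hom ≤ LinearMap.ker (rho U h) := by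
  rintro _ ⟨x, hx, rfl⟩
  have hx : rho V h x = 0 := hx
  rw [LinearMap.mem_ker, ← app_rho f h x, hx, map_zero]

theorem map_imPlus_le (c : Endpoint) (t : ℝ) :
    (imPlus V c t).map (f.app t).hom ≤ imPlus U c t :=
  le_iInf fun _ => le_iInf fun h => le_iInf fun hc =>
    (Submodule.map_mono (imPlus_le_range h hc)).trans (map_range_rho_le f h)

theorem map_kerPlus_le (c : Endpoint) (t : ℝ) :
    (kerPlus V c t).map (f.app t).hom ≤ kerPlus U c t :=
  le_iInf fun _ => le_iInf fun h => le_iInf fun hc =>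
    (Submodule.map_mono (kerPlus_le_ker h hc)).trans (map_ker_rho_le f h)

theorem map_imMinus_le (c : Endpoint) (t : ℝ) :
    (imMinus V c t).map (f.app t).hom ≤ imMinus U c t := by
  rw [Submodule.map_le_iff_le_comap]
  refine iSup_le fun s => iSup_le fun h => iSup_le fun hc => ?_
  rw [← Submodule.map_le_iff_le_comap]
  exact (map_range_rho_le f h).trans (range_le_imMinus h hc)

theorem map_kerMinus_le (c : Endpoint) (t : ℝ) :
    (kerMinus V c t).map (f.app t).hom ≤ kerMinus U c t := by
  rw [Submodule.map_le_iff_le_comap]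
  refine iSup_le fun s => iSup_le fun h => iSup_le fun hc => ?_
  rw [← Submodule.map_le_iff_le_comap]
  exact (map_ker_rho_le f h).trans (ker_le_kerMinus h hc)

variable {ι ι' : Type*} {K : ι → Interval} {w : ι → ∀ t : ℝ, V.obj t}
  {K' : ι' → Interval} {w' : ι' → ∀ t : ℝ, U.obj t}

theorem IsFrame.finrank_imPlus_inf_kerPlus (hV : PointwiseFinite V) (hw : IsFrame V K w)
    {a b : Endpoint} {t : ℝ} (hat : a ≤ Endpoint.minus t) (hbt : Endpoint.plus t ≤ b) :
      Module.finrank k (imPlus V a t ⊓ kerPlus V b t : Submodule k (V.obj t)) =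
        Module.finrank k (imPlus V a t ⊓ kerMinus V b t : Submodule k (V.obj t)) +
          {i | (K i).left ≤ a ∧ (K i).right = b}.ncard := by
  rw [hw.imPlus_eq, hw.kerPlus_eq hbt, hw.kerMinus_eq, hw.coordSub_inf, hw.coordSub_inf]
  refine hw.finrank_coordSub_add hV (fun i => ?_) fun i hi h => hi.2.ne h.2
  constructor
  · rintro ⟨⟨h1, h2⟩, h3⟩
    rcases h2.lt_or_eq with h2 | h2
    · exact Or.inl ⟨⟨h1, h2⟩, h3⟩
    · exact Or.inr ⟨h1, h2⟩
  · rintro (⟨⟨h1, h2⟩, h3⟩ | ⟨h1, h2⟩)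
    · exact ⟨⟨h1, h2.le⟩, h3⟩
    · exact ⟨⟨h1, h2.le⟩, h1.trans hat, h2.symm ▸ hbt⟩

theorem IsFrame.finrank_imPlus (hV : PointwiseFinite V) (hw : IsFrame V K w)
    {a b : Endpoint} {t : ℝ} (hat : a ≤ Endpoint.minus t) (hbt : Endpoint.plus t ≤ b) :
      Module.finrank k (imPlus V a t) =
        Module.finrank k
          (imMinus V a t ⊔ imPlus V a t ⊓ kerMinus V b t : Submodule k (V.obj t)) +
          {i | (K i).left = a ∧ b ≤ (K i).right}.ncard := by
  rw [hw.imPlus_eq, hw.imMinus_eq hat, hw.kerMinus_eq, hw.coordSub_inf, coordSub_sup]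
  refine hw.finrank_coordSub_add hV (fun i => ?_) ?_
  · constructor
    · rintro ⟨h1, h3⟩
      rcases h1.lt_or_eq with h1 | h1
      · exact Or.inl ⟨Or.inl h1, h3⟩
      · rcases lt_or_ge (K i).right b with h2 | h2
        · exact Or.inl ⟨Or.inr ⟨h1.le, h2⟩, h3⟩
        · exact Or.inr ⟨h1, h2⟩
    · rintro (⟨h1 | h1, h3⟩ | ⟨h1, h2⟩)
      · exact ⟨h1.le, h3⟩
      · exact ⟨h1.1, h3⟩
      · exact ⟨h1.le, h1.trans_le hat, hbt.trans h2⟩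
  · rintro i (h1 | h1) ⟨h2, h3⟩
    · exact h1.ne h2
    · exact h1.2.not_ge h3

theorem IsFrame.encard_le_of_injective (hV : PointwiseFinite V) (hU : PointwiseFinite U)
    (hw : IsFrame V K w) (hw' : IsFrame U K' w')
    (hf : ∀ t, Function.Injective (f.app t).hom) {a b : Endpoint} (hab : a < b) :
    {i | (K i).left ≤ a ∧ (K i).right = b}.encard ≤
      {i | (K' i).left ≤ a ∧ (K' i).right = b}.encard := by
  obtain ⟨t, hat, hbt⟩ := Endpoint.exists_between hab
  have := hV t
  have := hU t
  have h1 := hw.finrank_imPlus_inf_kerPlus hV hat hbt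
  have h2 := hw'.finrank_imPlus_inf_kerPlus hU hat hbt
  have h3 := finrank_add_le_of_inf_comap_le (f.app t).hom
    (A := imPlus V a t ⊓ kerPlus V b t) (B := imPlus V a t ⊓ kerMinus V b t)
    (A' := imPlus U a t ⊓ kerPlus U b t) (B' := imPlus U a t ⊓ kerMinus U b t)
    (le_inf ((Submodule.map_mono inf_le_left).trans (map_imPlus_le f a t))
      ((Submodule.map_mono inf_le_right).trans (map_kerPlus_le f b t)))
    -- By injectivity at r, an element whose image dies at r dies at r itself, so the preimage of
    -- Ker⁻ is contained in Ker⁻.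
    (inf_le_inf_left _ (kerMinus_le_kerPlus U b t)) (by
      rintro x ⟨⟨hx1, _⟩, _, hx2⟩
      refine ⟨hx1, ?_⟩
      obtain ⟨r, hr, hrb, hx⟩ := (mem_kerMinus hbt).1 hx2
      rw [← app_rho f hr] at hx
      exact (mem_kerMinus hbt).2 ⟨r, hr, hrb, hf r (hx.trans (map_zero _).symm)⟩)
  rw [← ((hw.finite_of_left_right hV hab).subset fun i hi => ⟨hi.1, hi.2.ge⟩).cast_ncard_eq,
    ← ((hw'.finite_of_left_right hU hab).subset fun i hi => ⟨hi.1, hi.2.ge⟩).cast_ncard_eq,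
    Nat.cast_le]
  omega

theorem IsFrame.encard_le_of_surjective (hV : PointwiseFinite V) (hU : PointwiseFinite U)
    (hw : IsFrame V K w) (hw' : IsFrame U K' w')
    (hf : ∀ t, Function.Surjective (f.app t).hom) {a b : Endpoint} (hab : a < b) :
    {i | (K' i).left = a ∧ b ≤ (K' i).right}.encard ≤
      {i | (K i).left = a ∧ b ≤ (K i).right}.encard := by
  obtain ⟨t, hat, hbt⟩ := Endpoint.exists_between hab
  have := hV t
  have := hU t
  have h1 := hw.finrank_imPlus hV hat hbt
  have h2 := hw'.finrank_imPlus hU hat hbt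
  have h3 := finrank_add_le_of_le_map (f.app t).hom
    (A := imPlus V a t) (B := imMinus V a t ⊔ imPlus V a t ⊓ kerMinus V b t)
    (A' := imPlus U a t) (B' := imMinus U a t ⊔ imPlus U a t ⊓ kerMinus U b t) (by
      -- Im⁺ of V is the image of a single ρ_{st}. An element of Im⁺ of U comes from U(s), and
      -- surjectivity at s lifts it to V(s).
      obtain ⟨s, hs, hsa, heq⟩ := exists_imPlus_eq hV hat
      rw [heq]
      intro y hy
      obtain ⟨z, rfl⟩ := imPlus_le_range hs hsa hy
      obtain ⟨x, rfl⟩ := hf s z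
      exact ⟨_, ⟨x, rfl⟩, app_rho f hs x⟩)
    (by
      rw [Submodule.map_sup]
      exact sup_le_sup (map_imMinus_le f a t)
        (le_inf ((Submodule.map_mono inf_le_left).trans (map_imPlus_le f a t))
          ((Submodule.map_mono inf_le_right).trans (map_kerMinus_le f b t))))
    (sup_le (imMinus_le_imPlus V a t) inf_le_left) (sup_le (imMinus_le_imPlus U a t) inf_le_left)
  rw [← ((hw.finite_of_left_right hV hab).subset fun i hi => ⟨hi.1.le, hi.2⟩).cast_ncard_eq,
    ← ((hw'.finite_of_left_right hU hab).subset fun i hi => ⟨hi.1.le, hi.2⟩).cast_ncard_eq,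
    Nat.cast_le]
  omega

end

/-! ### The Bauer-Lesnick matching -/

section

variable {V U : PersMod.{u, v} k}

theorem finite_rep_of_left_right (hV : PointwiseFinite V) {a b : Endpoint} (h : a < b) :
    {x : Rep (barcode V) | x.1.1.left ≤ a ∧ b ≤ x.1.1.right}.Finite := by
  obtain ⟨ι, K, w, hw⟩ := exists_isFrame hV
  obtain ⟨e, he⟩ := hw.exists_equiv_rep hV
  rw [← Set.encard_lt_top_iff, encard_setOf_rep e he fun I => I.left ≤ a ∧ b ≤ I.right]
  exact (hw.finite_of_left_right hV h).encard_lt_top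

theorem finite_rep_eq (hV : PointwiseFinite V) (I : Interval) :
    {x : Rep (barcode V) | x.1.1 = I}.Finite :=
  (finite_rep_of_left_right hV I.left_lt_right).subset fun x hx => by
    have hx : x.1.1 = I := hx
    exact ⟨(congrArg Interval.left hx).le, (congrArg Interval.right hx).ge⟩

theorem encard_rep_eq (hV : PointwiseFinite V) (I : Interval) :
    {x : Rep (barcode V) | x.1.1 = I}.encard = barcode V I := by
  obtain ⟨ι, K, w, hw⟩ := exists_isFrame hV
  obtain ⟨e, he⟩ := hw.exists_equiv_rep hV
  rw [encard_setOf_rep e he fun J => J = I, hw.barcode_eq hV]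

theorem rankRight_add_one_le {m : Barcode} {x : Rep m} {S : Set (Rep m)} (hx : x ∈ S)
    (h : ∀ y : Rep m, y.1.1.right = x.1.1.right →
      (y.1.1.left < x.1.1.left ∨ y.1.1.left = x.1.1.left ∧ y.1.2 < x.1.2) → y ∈ S) :
    rankRight x + 1 ≤ S.encard := by
  rw [rankRight, ← Set.encard_insert_of_notMem]
  · refine Set.encard_le_encard (Set.insert_subset hx fun y hy => h y hy.1 hy.2)
  · rintro ⟨-, h | h⟩
    · exact lt_irrefl _ h
    · exact lt_irrefl _ h.2

theorem rankLeft_add_one_le {m : Barcode} {x : Rep m} {S : Set (Rep m)} (hx : x ∈ S)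
    (h : ∀ y : Rep m, y.1.1.left = x.1.1.left →
      (x.1.1.right < y.1.1.right ∨ y.1.1.right = x.1.1.right ∧ y.1.2 < x.1.2) → y ∈ S) :
    rankLeft x + 1 ≤ S.encard := by
  rw [rankLeft, ← Set.encard_insert_of_notMem]
  · refine Set.encard_le_encard (Set.insert_subset hx fun y hy => h y hy.1 hy.2)
  · rintro ⟨-, h | h⟩
    · exact lt_irrefl _ h
    · exact lt_irrefl _ h.2

theorem rankRight_ne_top (hV : PointwiseFinite V) (x : Rep (barcode V)) : rankRight x ≠ ⊤ := by
  refine ((finite_rep_of_left_right hV x.1.1.left_lt_right).subset ?_).encard_lt_top.ne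
  rintro y ⟨h1, h2⟩
  exact ⟨h2.elim le_of_lt fun h => h.1.le, h1.ge⟩

theorem rankLeft_ne_top (hV : PointwiseFinite V) (x : Rep (barcode V)) : rankLeft x ≠ ⊤ := by
  refine ((finite_rep_of_left_right hV x.1.1.left_lt_right).subset ?_).encard_lt_top.ne
  rintro y ⟨h1, h2⟩
  exact ⟨h1.le, h2.elim le_of_lt fun h => h.1.ge⟩

theorem rankRight_injective (hV : PointwiseFinite V) {x y : Rep (barcode V)}
    (h : x.1.1.right = y.1.1.right) (hr : rankRight x = rankRight y) : x = y := by
  -- If x precedes y, then x and all its predecessors precede y, so the rank of y is strictly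
  -- larger; finiteness of ranks makes this strict.
  have key {x y : Rep (barcode V)} (h : x.1.1.right = y.1.1.right)
      (hr : rankRight x = rankRight y)
      (hlt : x.1.1.left < y.1.1.left ∨ x.1.1.left = y.1.1.left ∧ x.1.2 < y.1.2) : False := by
    have h1 : rankRight x + 1 ≤ rankRight y := by
      refine rankRight_add_one_le (x := x) ⟨h, hlt⟩ fun z hz hzx => ⟨hz.trans h, ?_⟩
      rcases hlt with h1 | ⟨h1, h1'⟩ <;> rcases hzx with h2 | ⟨h2, h2'⟩
      · exact Or.inl (h2.trans h1)
      · exact Or.inl (h2.trans_lt h1)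
      · exact Or.inl (h2.trans_eq h1)
      · exact Or.inr ⟨h2.trans h1, h2'.trans h1'⟩
    rw [← hr] at h1
    exact ((ENat.add_one_le_iff (rankRight_ne_top hV x)).1 h1).false
  rcases lt_trichotomy x.1.1.left y.1.1.left with h1 | h1 | h1
  · exact (key h hr (Or.inl h1)).elim
  · rcases lt_trichotomy x.1.2 y.1.2 with h2 | h2 | h2
    · exact (key h hr (Or.inr ⟨h1, h2⟩)).elim
    · exact Subtype.ext (Prod.ext (Interval.ext h1 h) h2)
    · exact (key h.symm hr.symm (Or.inr ⟨h1.symm, h2⟩)).elim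
  · exact (key h.symm hr.symm (Or.inl h1)).elim

theorem rankLeft_injective (hV : PointwiseFinite V) {x y : Rep (barcode V)}
    (h : x.1.1.left = y.1.1.left) (hr : rankLeft x = rankLeft y) : x = y := by
  have key {x y : Rep (barcode V)} (h : x.1.1.left = y.1.1.left)
      (hr : rankLeft x = rankLeft y)
      (hlt : y.1.1.right < x.1.1.right ∨ x.1.1.right = y.1.1.right ∧ x.1.2 < y.1.2) : False := by
    have h1 : rankLeft x + 1 ≤ rankLeft y := by
      refine rankLeft_add_one_le (x := x) ⟨h, hlt⟩ fun z hz hzx => ⟨hz.trans h, ?_⟩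
      rcases hlt with h1 | ⟨h1, h1'⟩ <;> rcases hzx with h2 | ⟨h2, h2'⟩
      · exact Or.inl (h1.trans h2)
      · exact Or.inl (h1.trans_eq h2.symm)
      · exact Or.inl (h1.symm.trans_lt h2)
      · exact Or.inr ⟨h2.trans h1, h2'.trans h1'⟩
    rw [← hr] at h1
    exact ((ENat.add_one_le_iff (rankLeft_ne_top hV x)).1 h1).false
  rcases lt_trichotomy x.1.1.right y.1.1.right with h1 | h1 | h1
  · exact (key h.symm hr.symm (Or.inl h1)).elim
  · rcases lt_trichotomy x.1.2 y.1.2 with h2 | h2 | h2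
    · exact (key h hr (Or.inr ⟨h1, h2⟩)).elim
    · exact Subtype.ext (Prod.ext (Interval.ext h h1) h2)
    · exact (key h.symm hr.symm (Or.inr ⟨h1.symm, h2⟩)).elim
  · exact (key h hr (Or.inl h1)).elim

/-- If y started after x, every bar of U with the same right endpoint starting no later than x would
precede y. Their number would be at most the common rank, whereas V has at least one more such bar,
namely x besides its predecessors. This contradicts `IsFrame.encard_le_of_injective`. -/
theorem left_le_of_matchInjective (hV : PointwiseFinite V) (hU : PointwiseFinite U) (f : V ⟶ U)
    (hf : ∀ t, Function.Injective (f.app t).hom) {x : Rep (barcode V)} {y : Rep (barcode U)}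
    (h : matchInjective _ _ x y) : y.1.1.left ≤ x.1.1.left := by
  obtain ⟨ι, K, w, hw⟩ := exists_isFrame hV
  obtain ⟨e, he⟩ := hw.exists_equiv_rep hV
  obtain ⟨ι', K', w', hw'⟩ := exists_isFrame hU
  obtain ⟨e', he'⟩ := hw'.exists_equiv_rep hU
  by_contra! hlt
  have h1 := hw.encard_le_of_injective f hV hU hw' hf x.1.1.left_lt_right
  rw [← encard_setOf_rep e he fun I => I.left ≤ x.1.1.left ∧ I.right = x.1.1.right,
    ← encard_setOf_rep e' he' fun I => I.left ≤ x.1.1.left ∧ I.right = x.1.1.right] at h1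
  have h2 := rankRight_add_one_le (x := x)
    (S := {z | z.1.1.left ≤ x.1.1.left ∧ z.1.1.right = x.1.1.right}) ⟨le_rfl, rfl⟩
    fun z hz hzx => ⟨hzx.elim le_of_lt fun h => h.1.le, hz⟩
  have h3 : {z : Rep (barcode U) | z.1.1.left ≤ x.1.1.left ∧ z.1.1.right = x.1.1.right}.encard ≤
      rankRight y :=
    Set.encard_le_encard fun z hz => ⟨hz.2.trans h.1, Or.inl (hz.1.trans_lt hlt)⟩
  have h4 := h2.trans (h1.trans h3)
  rw [← h.2] at h4
  exact ((ENat.add_one_le_iff (rankRight_ne_top hV x)).1 h4).false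

theorem right_le_of_matchSurjective (hV : PointwiseFinite V) (hU : PointwiseFinite U) (f : V ⟶ U)
    (hf : ∀ t, Function.Surjective (f.app t).hom) {x : Rep (barcode V)} {y : Rep (barcode U)}
    (h : matchSurjective _ _ x y) : y.1.1.right ≤ x.1.1.right := by
  obtain ⟨ι, K, w, hw⟩ := exists_isFrame hV
  obtain ⟨e, he⟩ := hw.exists_equiv_rep hV
  obtain ⟨ι', K', w', hw'⟩ := exists_isFrame hU
  obtain ⟨e', he'⟩ := hw'.exists_equiv_rep hU
  by_contra! hlt
  have h1 := hw.encard_le_of_surjective f hV hU hw' hf y.1.1.left_lt_right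
  rw [← encard_setOf_rep e he fun I => I.left = y.1.1.left ∧ y.1.1.right ≤ I.right,
    ← encard_setOf_rep e' he' fun I => I.left = y.1.1.left ∧ y.1.1.right ≤ I.right] at h1
  have h2 := rankLeft_add_one_le (x := y)
    (S := {z | z.1.1.left = y.1.1.left ∧ y.1.1.right ≤ z.1.1.right}) ⟨rfl, le_rfl⟩
    fun z hz hzx => ⟨hz, hzx.elim le_of_lt fun h => h.1.ge⟩
  have h3 : {z : Rep (barcode V) | z.1.1.left = y.1.1.left ∧ y.1.1.right ≤ z.1.1.right}.encard ≤
      rankLeft x :=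
    Set.encard_le_encard fun z hz => ⟨hz.1.trans h.1.symm, Or.inl (hlt.trans_le hz.2)⟩
  have h4 := h2.trans (h1.trans h3)
  rw [h.2] at h4
  exact ((ENat.add_one_le_iff (rankLeft_ne_top hU y)).1 h4).false

/-- The inclusion `Im f → U`. -/
def imageInclusion (f : V ⟶ U) : image f ⟶ U where
  app t := ModuleCat.ofHom (LinearMap.range (f.app t).hom).subtype
  naturality _ _ _ := rfl

/-- The projection `V → Im f`. -/
def imageProjection (f : V ⟶ U) : V ⟶ image f where
  app t := ModuleCat.ofHom (f.app t).hom.rangeRestrict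
  naturality _ _ h :=
    ModuleCat.hom_ext (LinearMap.ext fun x => Subtype.ext (app_rho f (leOfHom h) x))

theorem imageInclusion_injective (f : V ⟶ U) (t : ℝ) :
    Function.Injective ((imageInclusion f).app t).hom := Subtype.val_injective

theorem imageProjection_surjective (f : V ⟶ U) (t : ℝ) :
    Function.Surjective ((imageProjection f).app t).hom := by
  rintro ⟨_, x, rfl⟩
  exact ⟨x, rfl⟩

theorem pointwiseFinite_image (hU : PointwiseFinite U) (f : V ⟶ U) :
    PointwiseFinite (image f) := fun t => by
  have := hU t
  exact inferInstanceAs (FiniteDimensional k (LinearMap.range (f.app t).hom))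

/-- The intermediate bar z of Im f has the left endpoint of x and the right endpoint of y. The last
inequality says that z is nonempty. -/
theorem left_right_le_of_chi (hV : PointwiseFinite V) (hU : PointwiseFinite U) (f : V ⟶ U)
    {x : Rep (barcode V)} {y : Rep (barcode U)} (h : chi f x y) :
    y.1.1.left ≤ x.1.1.left ∧ y.1.1.right ≤ x.1.1.right ∧ x.1.1.left < y.1.1.right := by
  obtain ⟨z, h1, h2⟩ := h
  have hM := pointwiseFinite_image hU f
  have h3 := right_le_of_matchSurjective hV hM _ (imageProjection_surjective f) h1
  have h4 := left_le_of_matchInjective hM hU _ (imageInclusion_injective f) h2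
  have h5 := z.1.1.left_lt_right
  rw [← h1.1] at h4 h5
  rw [h2.1] at h3 h5
  exact ⟨h4, h3, h5⟩

theorem biUnique_chi (hV : PointwiseFinite V) (hU : PointwiseFinite U) (f : V ⟶ U) :
    Relator.BiUnique (chi f) := by
  have hM := pointwiseFinite_image hU f
  constructor
  · rintro x x' y ⟨z, h1, h2⟩ ⟨z', h1', h2'⟩
    obtain rfl := rankRight_injective hM (h2.1.trans h2'.1.symm) (h2.2.trans h2'.2.symm)
    exact rankLeft_injective hV (h1.1.trans h1'.1.symm) (h1.2.trans h1'.2.symm)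
  · rintro x y y' ⟨z, h1, h2⟩ ⟨z', h1', h2'⟩
    obtain rfl := rankLeft_injective hM (h1.1.symm.trans h1'.1) (h1.2.symm.trans h1'.2)
    exact rankRight_injective hU (h2.1.symm.trans h2'.1) (h2.2.symm.trans h2'.2)

end

/-! ### The morphism of a matching of generators -/

section

variable {V U : PersMod.{u, v} k} {ι ι' : Type} {K : ι → Interval} {w : ι → ∀ t : ℝ, V.obj t}
  {K' : ι' → Interval} {w' : ι' → ∀ t : ℝ, U.obj t} (R : ι → ι' → Prop)

open Classical in
/-- The vector of the generator that is matched with `i`, and `0` if there is none. -/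
noncomputable def matchVec (w' : ι' → ∀ t : ℝ, U.obj t) (i : ι) (t : ℝ) : U.obj t :=
  if h : ∃ j, R i j then w' h.choose t else 0

variable {R}

theorem matchVec_of_rel (hR : Relator.BiUnique R) {i : ι} {j : ι'} (h : R i j) (t : ℝ) :
    matchVec R w' i t = w' j t := by
  have h' : ∃ j, R i j := ⟨j, h⟩
  rw [matchVec, dif_pos h', hR.2 h'.choose_spec h]

theorem matchVec_of_forall_not {i : ι} (h : ∀ j, ¬ R i j) (t : ℝ) :
    matchVec R w' i t = 0 :=
  dif_neg fun ⟨j, hj⟩ => h j hj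

/-- When s lies beyond the left end but outside the bar, the bar has already ended, and both sides
vanish. -/
theorem rho_vec (hw' : IsFrame U K' w') {j : ι'} {s t : ℝ} (h : s ≤ t)
    (hj : (K' j).left ≤ Endpoint.minus s) : rho U h (w' j s) = w' j t := by
  by_cases hs : s ∈ K' j
  · exact hw'.rho_eq j h hs
  · rw [hw'.eq_zero j s hs, map_zero, hw'.eq_zero j t]
    exact fun ht => hs ((Interval.mem_iff_of_le h ht).2 hj)

/-- The morphism that sends each generator to its partner, and to `0` if there is none. -/
noncomputable def matchHom (hw : IsFrame V K w) (hw' : IsFrame U K' w') (hR : Relator.BiUnique R)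
    (hle : ∀ i j, R i j → (K' j).left ≤ (K i).left ∧ (K' j).right ≤ (K i).right) : V ⟶ U where
  app t := ModuleCat.ofHom ((hw.basis t).constr k fun i => matchVec R w' i.1 t)
  naturality s t h := by
    refine ModuleCat.hom_ext ((hw.basis s).ext fun i => ?_)
    change (hw.basis t).constr k _ (rho V (leOfHom h) (hw.basis s i)) =
      rho U (leOfHom h) ((hw.basis s).constr k _ (hw.basis s i))
    rw [Module.Basis.constr_basis, hw.basis_apply, hw.rho_eq _ _ i.2]
    have hr : rho U (leOfHom h) (matchVec R w' i.1 s) = matchVec R w' i.1 t := by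
      by_cases hi : ∃ j, R i.1 j
      · obtain ⟨j, hj⟩ := hi
        rw [matchVec_of_rel hR hj, matchVec_of_rel hR hj,
          rho_vec hw' _ ((hle _ _ hj).1.trans i.2.1)]
      · have hi := not_exists.1 hi
        rw [matchVec_of_forall_not hi, matchVec_of_forall_not hi, map_zero]
    rw [hr]
    -- Once t has left the bar of i, the partner must vanish too; this is where its ending no later
    -- is needed. The left inequality served in `hr`.
    by_cases ht : t ∈ K i
    · rw [← hw.basis_apply t ⟨i, ht⟩, Module.Basis.constr_basis]
    · rw [hw.eq_zero _ _ ht, map_zero]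
      by_cases hi : ∃ j, R i.1 j
      · obtain ⟨j, hj⟩ := hi
        rw [matchVec_of_rel hR hj, hw'.eq_zero]
        intro ht'
        exact ht ⟨i.2.1.trans (Endpoint.minus_mono (leOfHom h)), ht'.2.trans (hle _ _ hj).2⟩
      · rw [matchVec_of_forall_not (not_exists.1 hi)]

variable (hw : IsFrame V K w) (hw' : IsFrame U K' w') (hR : Relator.BiUnique R)
  (hle : ∀ i j, R i j → (K' j).left ≤ (K i).left ∧ (K' j).right ≤ (K i).right)

theorem matchHom_app {i : ι} {t : ℝ} (hi : t ∈ K i) :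
    ((matchHom hw hw' hR hle).app t).hom (w i t) = matchVec R w' i t := by
  change (hw.basis t).constr k (fun i => matchVec R w' i.1 t) (w i t) = _
  rw [← hw.basis_apply t ⟨i, hi⟩, Module.Basis.constr_basis]

/-- Each generator goes to a single generator or to 0, so coordinate subspaces go to coordinate
subspaces. The condition t ∈ K i cannot be dropped: outside its bar generator i is 0, although its
partner might not be. -/
theorem map_matchHom_coordSub (t : ℝ) (S : ι → Prop) :
    (coordSub w t S).map ((matchHom hw hw' hR hle).app t).hom =
      coordSub w' t (fun j => ∃ i, t ∈ K i ∧ R i j ∧ S i) := by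
  refine le_antisymm ?_ (coordSub_le_iff.2 ?_)
  · rw [Submodule.map_le_iff_le_comap, coordSub_le_iff]
    intro i hi
    rw [Submodule.mem_comap]
    by_cases ht : t ∈ K i
    · rw [matchHom_app hw hw' hR hle ht]
      by_cases h : ∃ j, R i j
      · obtain ⟨j, hj⟩ := h
        rw [matchVec_of_rel hR hj]
        exact mem_coordSub_of w' t ⟨i, ht, hj, hi⟩
      · rw [matchVec_of_forall_not (not_exists.1 h)]
        exact zero_mem _
    · rw [hw.eq_zero i t ht, map_zero]
      exact zero_mem _
  · rintro j ⟨i, ht, hj, hi⟩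
    refine ⟨w i t, mem_coordSub_of w t hi, ?_⟩
    rw [matchHom_app hw hw' hR hle ht, matchVec_of_rel hR hj]

theorem yPlus_matchHom {I J : Interval} {t : ℝ} (hI : t ∈ I) (hJ : t ∈ J) :
    (yPlus (matchHom hw hw' hR hle) I J).carrier t = coordSub w' t (fun j =>
      (∃ i, t ∈ K i ∧ R i j ∧ (K i).left ≤ I.left ∧ (K i).right ≤ I.right) ∧
        (K' j).left ≤ J.left ∧ (K' j).right ≤ J.right) := by
  change ((plusSub V I).carrier t).map _ ⊓ (plusSub U J).carrier t = _
  rw [hw.plusSub_eq hI, hw'.plusSub_eq hJ, map_matchHom_coordSub, hw'.coordSub_inf]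

theorem yMinus_matchHom {I J : Interval} {t : ℝ} (hI : t ∈ I) (hJ : t ∈ J) :
    (yMinus (matchHom hw hw' hR hle) I J).carrier t = coordSub w' t (fun j =>
      (∃ i, t ∈ K i ∧ R i j ∧ ((K i).left ≤ I.left ∧ (K i).right ≤ I.right) ∧ K i ≠ I) ∨
        ((K' j).left ≤ J.left ∧ (K' j).right ≤ J.right) ∧ K' j ≠ J) := by
  change ((minusSub V I).carrier t).map _ ⊔ (minusSub U J).carrier t = _
  rw [hw.minusSub_eq hI, hw'.minusSub_eq hJ, map_matchHom_coordSub, coordSub_sup]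

theorem yPlus_eq_bot (g : V ⟶ U) {I J : Interval} {t : ℝ} (h : ¬ (t ∈ I ∧ t ∈ J)) :
    (yPlus g I J).carrier t = ⊥ := by
  change ((plusSub V I).carrier t).map _ ⊓ (plusSub U J).carrier t = _
  by_cases hI : t ∈ I
  · rw [plusSub_carrier_of_not_mem fun hJ => h ⟨hI, hJ⟩, inf_bot_eq]
  · rw [plusSub_carrier_of_not_mem hI, Submodule.map_bot, bot_inf_eq]

/-- The class in `A(t) / (B(t) ∩ A(t))` of an element of `A(t)`. -/
def Sub.mkQuotient (A B : Sub U) (t : ℝ) : A.carrier t →ₗ[k] (A.quotient B).obj t :=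
  Submodule.mkQ _

theorem Sub.mkQuotient_surjective (A B : Sub U) (t : ℝ) :
    Function.Surjective (A.mkQuotient B t) :=
  Submodule.mkQ_surjective _

theorem Sub.mkQuotient_eq_zero {A B : Sub U} {t : ℝ} {x : A.carrier t} :
    A.mkQuotient B t x = 0 ↔ x.1 ∈ B.carrier t :=
  (Submodule.Quotient.mk_eq_zero _).trans ⟨fun h => h.1, fun h => ⟨h, x.2⟩⟩

theorem Sub.rho_mkQuotient (A B : Sub U) {s t : ℝ} (h : s ≤ t) (x : A.carrier s) :
    rho (A.quotient B) h (A.mkQuotient B s x) =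
      A.mkQuotient B t ⟨rho U h x.1, A.map_mem h x.1 x.2⟩ := rfl

theorem pointwiseFinite_xMod (hU : PointwiseFinite U) (g : V ⟶ U) (I J : Interval) :
    PointwiseFinite (xMod g I J) := fun t => by
  have := hU t
  exact Module.Finite.of_surjective _ (Sub.mkQuotient_surjective (yPlus g I J) (yMinus g I J) t)

theorem subsingleton_xMod (g : V ⟶ U) {I J : Interval} {t : ℝ} (h : ¬ (t ∈ I ∧ t ∈ J)) :
    Subsingleton ((xMod g I J).obj t) := by
  have : Subsingleton ((yPlus g I J).carrier t) := by
    rw [yPlus_eq_bot g h]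
    infer_instance
  exact (Sub.mkQuotient_surjective (yPlus g I J) (yMinus g I J) t).subsingleton

end

/-! ### The modules X_{IJ} of a matching morphism -/

section

variable {V U : PersMod.{u, v} k} {ι ι' : Type} {K : ι → Interval} {w : ι → ∀ t : ℝ, V.obj t}
  {K' : ι' → Interval} {w' : ι' → ∀ t : ℝ, U.obj t} {R : ι → ι' → Prop}

/-- For the morphism of a matching, the generators of `X_{IJ}` are the matched pairs that consist
of a copy of `I` and a copy of `J`. -/
theorem exists_isFrame_xMod (hw : IsFrame V K w) (hw' : IsFrame U K' w')
    (hR : Relator.BiUnique R)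
    (hle : ∀ i j, R i j → (K' j).left ≤ (K i).left ∧ (K' j).right ≤ (K i).right)
    (hlt : ∀ i j, R i j → (K i).left < (K' j).right) (I J : Interval) :
    ∃ (L : {p : ι × ι' // R p.1 p.2 ∧ K p.1 = I ∧ K' p.2 = J} → Interval)
      (x : {p : ι × ι' // R p.1 p.2 ∧ K p.1 = I ∧ K' p.2 = J} →
        ∀ t : ℝ, (xMod (matchHom hw hw' hR hle) I J).obj t),
      IsFrame (xMod (matchHom hw hw' hR hle) I J) L x := by
  classical
  set g := matchHom hw hw' hR hle
  let κ := {p : ι × ι' // R p.1 p.2 ∧ K p.1 = I ∧ K' p.2 = J}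
  -- Since J starts and ends no later than I, this is I ∩ J; `hlt` makes it nonempty.
  let L (p : κ) : Interval := ⟨I.left, J.right, by
    have := hlt _ _ p.2.1
    rwa [p.2.2.1, p.2.2.2] at this⟩
  have hL (p : κ) (t : ℝ) : t ∈ L p ↔ t ∈ I ∧ t ∈ J := by
    have := hle _ _ p.2.1
    rw [p.2.2.1, p.2.2.2] at this
    exact ⟨fun h => ⟨⟨h.1, h.2.trans this.2⟩, this.1.trans h.1, h.2⟩, fun h => ⟨h.1.1, h.2.2⟩⟩
  -- The cutoff is needed because `w' p.1.2 t` is nonzero on all of J, while Y⁺ vanishes outside I ∩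
  -- J.
  have hmem (p : κ) (t : ℝ) : (if t ∈ L p then w' p.1.2 t else 0) ∈ (yPlus g I J).carrier t := by
    split_ifs with h
    · obtain ⟨hI, hJ⟩ := (hL p t).1 h
      rw [yPlus_matchHom hw hw' hR hle hI hJ]
      refine mem_coordSub_of w' t ⟨⟨p.1.1, ?_, p.2.1, ?_⟩, ?_⟩
      · rwa [p.2.2.1]
      · rw [p.2.2.1]
        exact ⟨le_rfl, le_rfl⟩
      · rw [p.2.2.2]
        exact ⟨le_rfl, le_rfl⟩
    · exact zero_mem _
  let x (p : κ) (t : ℝ) : (xMod g I J).obj t :=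
    Sub.mkQuotient (yPlus g I J) (yMinus g I J) t ⟨_, hmem p t⟩
  refine ⟨L, x, fun p t ht => ?_, fun p s t h hs => ?_, fun t => ?_, fun t => ?_⟩
  · refine Sub.mkQuotient_eq_zero.2 ?_
    simp only [if_neg ht]
    exact zero_mem _
  · by_cases ht : t ∈ L p
    · refine (Sub.rho_mkQuotient _ _ h _).trans ?_
      refine congrArg (Sub.mkQuotient (yPlus g I J) (yMinus g I J) t) (Subtype.ext ?_)
      simp only [if_pos hs, if_pos ht]
      refine hw'.rho_eq _ h ?_
      rw [p.2.2.2]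
      exact ((hL p s).1 hs).2
    · have := subsingleton_xMod g (mt (hL p t).2 ht)
      exact Subsingleton.elim _ _
  · rw [linearIndepOn_iff]
    intro l hl hl0
    ext p
    by_contra hp
    have htp : t ∈ L p := hl (Finsupp.mem_support_iff.2 hp)
    obtain ⟨hI, hJ⟩ := (hL p t).1 htp
    have h1 : Sub.mkQuotient (yPlus g I J) (yMinus g I J) t
        (∑ q ∈ l.support, l q • ⟨_, hmem q t⟩) = 0 := by
      refine Eq.trans ?_ hl0
      rw [Finsupp.linearCombination_apply, Finsupp.sum, map_sum]
      exact Finset.sum_congr rfl fun q _ => map_smul _ _ _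
    rw [Sub.mkQuotient_eq_zero, yMinus_matchHom hw hw' hR hle hI hJ, hw'.mem_coordSub] at h1
    have htJ : t ∈ K' p.1.2 := by rwa [p.2.2.2]
    -- Distinct pairs have distinct second entries because the matching is injective on both sides,
    -- so only p contributes to this coordinate.
    have h2 : (hw'.basis t).repr (∑ q ∈ l.support, l q •
        (⟨_, hmem q t⟩ : (yPlus g I J).carrier t) : (yPlus g I J).carrier t).1 ⟨p.1.2, htJ⟩ =
        l p := by
      rw [Submodule.coe_sum, map_sum, Finsupp.finsetSum_apply,
        Finset.sum_eq_single_of_mem p (Finsupp.mem_support_iff.2 hp)]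
      · rw [Submodule.coe_smul, map_smul, Finsupp.smul_apply]
        simp only [if_pos htp]
        rw [← hw'.basis_apply t ⟨p.1.2, htJ⟩, Module.Basis.repr_self, Finsupp.single_eq_same,
          smul_eq_mul, mul_one]
      · intro q hq hqp
        have htq : t ∈ L q := hl hq
        have htJ' : t ∈ K' q.1.2 := by rwa [q.2.2.2]
        rw [Submodule.coe_smul, map_smul, Finsupp.smul_apply]
        simp only [if_pos htq]
        rw [← hw'.basis_apply t ⟨q.1.2, htJ'⟩, Module.Basis.repr_self, Finsupp.single_eq_of_ne,
          smul_zero]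
        intro h
        have h' : p.1.2 = q.1.2 := congrArg Subtype.val h
        refine hqp (Subtype.ext (Prod.ext (hR.1 q.2.1 ?_) h'.symm))
        rw [← h']
        exact p.2.1
    -- A nonzero coordinate of an element of Y⁻ belongs to a generator that is not a copy of J or
    -- whose partner is not a copy of I; p is neither.
    rcases h1 ⟨p.1.2, htJ⟩ (h2.trans_ne hp) with ⟨i, _, hij, _, hi⟩ | ⟨_, hj⟩
    · rw [hR.1 hij p.2.1] at hi
      exact hi p.2.2.1
    · exact hj p.2.2.2
  · by_cases ht : t ∈ I ∧ t ∈ J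
    · obtain ⟨hI, hJ⟩ := ht
      refine eq_top_iff.2 fun z _ => ?_
      obtain ⟨⟨y, hy⟩, rfl⟩ := Sub.mkQuotient_surjective (yPlus g I J) (yMinus g I J) t z
      have key : (yPlus g I J).carrier t ≤ ((Submodule.span k (Set.range fun p => x p t)).comap
          (Sub.mkQuotient (yPlus g I J) (yMinus g I J) t)).map
            ((yPlus g I J).carrier t).subtype := by
        conv_lhs => rw [yPlus_matchHom hw hw' hR hle hI hJ]
        rw [coordSub_le_iff]
        intro j hj
        have hjY : w' j t ∈ (yPlus g I J).carrier t := by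
          rw [yPlus_matchHom hw hw' hR hle hI hJ]
          exact mem_coordSub_of w' t hj
        refine ⟨⟨w' j t, hjY⟩, ?_, rfl⟩
        obtain ⟨⟨i, hi, hij, hiI⟩, hjJ⟩ := hj
        change Sub.mkQuotient (yPlus g I J) (yMinus g I J) t ⟨w' j t, hjY⟩ ∈
          Submodule.span k (Set.range fun p => x p t)
        -- A generator in Y⁺ either belongs to a pair in κ or already lies in Y⁻.
        by_cases hKI : K i = I ∧ K' j = J
        · let p : κ := ⟨(i, j), hij, hKI.1, hKI.2⟩
          refine Submodule.subset_span ⟨p, ?_⟩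
          refine congrArg (Sub.mkQuotient (yPlus g I J) (yMinus g I J) t) (Subtype.ext ?_)
          exact if_pos ((hL p t).2 ⟨hI, hJ⟩)
        · rw [Sub.mkQuotient_eq_zero.2]
          · exact zero_mem _
          · rw [yMinus_matchHom hw hw' hR hle hI hJ]
            refine mem_coordSub_of w' t ?_
            rcases not_and_or.1 hKI with h | h
            · exact Or.inl ⟨i, hi, hij, hiI, h⟩
            · exact Or.inr ⟨hjJ, h⟩
      obtain ⟨⟨y', hy'⟩, hz, rfl⟩ := key hy
      exact hz
    · have := subsingleton_xMod g ht
      exact Subsingleton.elim _ _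

theorem inducedMatching_matchHom (hU : PointwiseFinite U) (hw : IsFrame V K w)
    (hw' : IsFrame U K' w') (hR : Relator.BiUnique R)
    (hle : ∀ i j, R i j → (K' j).left ≤ (K i).left ∧ (K' j).right ≤ (K i).right)
    (hlt : ∀ i j, R i j → (K i).left < (K' j).right) (I J : Interval) :
    inducedMatching (matchHom hw hw' hR hle) I J =
      {i | K i = I ∧ ∃ j, R i j ∧ K' j = J}.encard := by
  obtain ⟨L, x, hx⟩ := exists_isFrame_xMod hw hw' hR hle hlt I J
  obtain ⟨e, _⟩ := hx.exists_equiv_rep (pointwiseFinite_xMod hU _ I J)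
  let φ (p : {p : ι × ι' // R p.1 p.2 ∧ K p.1 = I ∧ K' p.2 = J}) :
      {i | K i = I ∧ ∃ j, R i j ∧ K' j = J} := ⟨p.1.1, p.2.2.1, p.1.2, p.2.1, p.2.2.2⟩
  have hφ : Function.Bijective φ := by
    constructor
    · intro p q h
      have h' : p.1.1 = q.1.1 := congrArg Subtype.val h
      refine Subtype.ext (Prod.ext h' (hR.2 p.2.1 ?_))
      rw [h']
      exact q.2.1
    · rintro ⟨i, hi, j, hij, hj⟩
      exact ⟨⟨(i, j), hij, hi, hj⟩, rfl⟩
  exact Set.encard_congr (e.symm.trans (Equiv.ofBijective φ hφ))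

end

/-! ### Partial matchings from representations, and the theorem -/

theorem sum_encard_le {α β : Type*} (F : Finset β) (S : β → Set α) (T : Set α)
    (hST : ∀ b, S b ⊆ T) (hdisj : ∀ a b c, a ∈ S b → a ∈ S c → b = c) :
    ∑ b ∈ F, (S b).encard ≤ T.encard := by
  classical
  have h : ∑ b ∈ F, (S b).encard = (⋃ b ∈ F, S b).encard := by
    induction F using Finset.induction_on with
    | empty => simp
    | insert b F hb ih =>
      rw [Finset.sum_insert hb, ih, Finset.set_biUnion_insert, Set.encard_union_eq]
      refine Set.disjoint_left.2 fun a ha ha' => hb ?_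
      obtain ⟨c, hc, hac⟩ := Set.mem_iUnion₂.1 ha'
      rwa [hdisj a b c ha hac]
  rw [h]
  exact Set.encard_le_encard (Set.iUnion₂_subset fun b _ => hST b)

theorem IsRepresentation.isPartialMatching {V U : PersMod.{u, v} k} (hV : PointwiseFinite V)
    (hU : PointwiseFinite U) {M : Interval → Interval → ℕ∞}
    {R : Rep (barcode V) → Rep (barcode U) → Prop} (h : IsRepresentation M R) :
    IsPartialMatching (barcode V) (barcode U) M := by
  obtain ⟨hR, hM⟩ := h
  refine ⟨fun I J => ?_, fun I F => ?_, fun J F => ?_⟩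
  · rw [hM]
    exact ((finite_rep_eq hV I).subset fun x hx => hx.1).encard_lt_top.ne
  · rw [← encard_rep_eq hV, Finset.sum_congr rfl fun J _ => hM I J]
    refine sum_encard_le F _ _ (fun J x hx => hx.1) ?_
    rintro x J J' ⟨_, y, hxy, rfl⟩ ⟨_, y', hxy', rfl⟩
    rw [hR.2 hxy hxy']
  -- For the column sums the matched pairs are counted by their second entries, which gives disjoint
  -- sets of copies of J.
  · have h1 (I : Interval) : M I J =
        {y : Rep (barcode U) | y.1.1 = J ∧ ∃ x, R x y ∧ x.1.1 = I}.encard := by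
      rw [hM]
      have h2 (x : {x : Rep (barcode V) | x.1.1 = I ∧ ∃ y, R x y ∧ y.1.1 = J}) :
          ∃ y : {y : Rep (barcode U) | y.1.1 = J ∧ ∃ x, R x y ∧ x.1.1 = I}, R x.1 y.1 := by
        obtain ⟨x, hx, y, hxy, hy⟩ := x
        exact ⟨⟨y, hy, x, hxy, hx⟩, hxy⟩
      choose φ hφ using h2
      refine Set.encard_congr (Equiv.ofBijective φ ⟨fun x x' hxx => ?_, ?_⟩)
      · have := hφ x
        rw [hxx] at this
        exact Subtype.ext (hR.1 this (hφ x'))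
      · rintro ⟨y, hy, x, hxy, hx⟩
        exact ⟨⟨x, hx, y, hxy, hy⟩, Subtype.ext (hR.2 (hφ _) hxy)⟩
    rw [← encard_rep_eq hU, Finset.sum_congr rfl fun I _ => h1 I]
    refine sum_encard_le F _ _ (fun J x hx => hx.1) ?_
    rintro y I I' ⟨_, x, hxy, rfl⟩ ⟨_, x', hxy', rfl⟩
    rw [hR.1 hxy hxy']

theorem exists_labelling {V : PersMod.{u, v} k} (hV : PointwiseFinite V) :
    ∃ α : PersistenceBasis V, Nonempty (Labelling α) := by
  obtain ⟨ι, K, w, hw⟩ := exists_isFrame hV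
  obtain ⟨e, he⟩ := hw.exists_equiv_rep hV
  exact ⟨hw.toBasis, ⟨⟨e, he⟩⟩⟩

end PersMatch

theorem mainTheorem5 {k : Type*} [Field k] (V U : PersMatch.PersMod k)
    (hV : PersMatch.PointwiseFinite V) (hU : PersMatch.PointwiseFinite U) (f : V ⟶ U) :
    -- the barcodes and labelled persistence bases that occur below exist
    (∃ α : PersMatch.PersistenceBasis V, Nonempty (PersMatch.Labelling α)) ∧
    (∃ β : PersMatch.PersistenceBasis U, Nonempty (PersMatch.Labelling β)) ∧
    PersMatch.IsDecomposable (PersMatch.image f) ∧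
    ∀ (α : PersMatch.PersistenceBasis V) (σ : PersMatch.Labelling α)
      (β : PersMatch.PersistenceBasis U) (τ : PersMatch.Labelling β),
      ∃ g : V ⟶ U,
        -- `g` sends each matched generator to its partner, by the identity on `I ∩ J`
        (∀ i j, PersMatch.chi f (σ.toEquiv i) (τ.toEquiv j) → ∀ t : ℝ,
          (g.app t).hom ∘ₗ α.gen i t =
            β.gen j t ∘ₗ PersMatch.intervalMap k (α.interval i) (β.interval j) t t) ∧
        -- and each unmatched generator to zero
        (∀ i, (∀ y, ¬ PersMatch.chi f (σ.toEquiv i) y) → ∀ t : ℝ,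
          (g.app t).hom ∘ₗ α.gen i t = 0) ∧
        -- `χ_f` is a representation of the partial matching `𝓜_g`
        (∀ I J, PersMatch.IsDecomposable (PersMatch.xMod g I J)) ∧
        PersMatch.IsPartialMatching (PersMatch.barcode V) (PersMatch.barcode U)
          (PersMatch.inducedMatching g) ∧
        PersMatch.IsRepresentation (PersMatch.inducedMatching g) (PersMatch.chi f) := by
  open PersMatch in
  refine ⟨exists_labelling hV, exists_labelling hU,
    PersistenceBasis.nonempty (pointwiseFinite_image hU f), fun α σ β τ => ?_⟩
  have hχ := biUnique_chi hV hU f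
  -- The labellings transport χ_f to a matching of the generators themselves.
  let R (i : α.ι) (j : β.ι) : Prop := chi f (σ.toEquiv i) (τ.toEquiv j)
  have hR : Relator.BiUnique R :=
    ⟨fun i i' j h h' => σ.toEquiv.injective (hχ.1 h h'),
      fun i j j' h h' => τ.toEquiv.injective (hχ.2 h h')⟩
  have hlr (i j) (h : R i j) := left_right_le_of_chi hV hU f h
  simp only [σ.interval_eq, τ.interval_eq] at hlr
  have hle (i j) (h : R i j) : (β.interval j).left ≤ (α.interval i).left ∧
      (β.interval j).right ≤ (α.interval i).right := ⟨(hlr i j h).1, (hlr i j h).2.1⟩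
  have hlt (i j) (h : R i j) : (α.interval i).left < (β.interval j).right := (hlr i j h).2.2
  have hrep : IsRepresentation (inducedMatching (matchHom α.isFrame β.isFrame hR hle)) (chi f) := by
    refine ⟨hχ, fun I J => ?_⟩
    rw [inducedMatching_matchHom hU α.isFrame β.isFrame hR hle hlt]
    refine Set.encard_congr (Equiv.subtypeEquiv σ.toEquiv fun i => ?_)
    change α.interval i = I ∧ (∃ j, R i j ∧ β.interval j = J) ↔ _
    rw [← σ.interval_eq]
    refine and_congr_right fun _ => ⟨?_, ?_⟩
    · rintro ⟨j, hij, hj⟩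
      exact ⟨τ.toEquiv j, hij, (τ.interval_eq j).trans hj⟩
    · rintro ⟨y, hxy, hy⟩
      obtain ⟨j, rfl⟩ := τ.toEquiv.surjective y
      exact ⟨j, hxy, (τ.interval_eq j).symm.trans hy⟩
  refine ⟨matchHom α.isFrame β.isFrame hR hle, fun i j hij t => ?_, fun i hi t => ?_, fun I J =>
    PersistenceBasis.nonempty (pointwiseFinite_xMod hU _ I J), hrep.isPartialMatching hV hU, hrep⟩
  · refine LinearMap.ext fun x => ?_
    by_cases ht : t ∈ α.interval i
    · rw [LinearMap.comp_apply, α.gen_apply, map_smul, matchHom_app _ _ _ _ ht,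
        matchVec_of_rel hR hij, LinearMap.comp_apply]
      -- Both sides are determined by their value on the generator of k_I(t).
      conv_rhs => rw [eq_smul_intervalGen x, map_smul, map_smul, intervalMap_intervalGen ht]
      rfl
    · rw [intervalSpace_eq_zero ht x, map_zero, map_zero]
  · refine LinearMap.ext fun x => ?_
    by_cases ht : t ∈ α.interval i
    · rw [LinearMap.comp_apply, α.gen_apply, map_smul, matchHom_app _ _ _ _ ht,
        matchVec_of_forall_not (R := R) fun j => hi _, smul_zero, LinearMap.zero_apply]
    · rw [intervalSpace_eq_zero ht x, map_zero, map_zero]
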